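/- Let $\mathbb Z^2$ be the square lattice with edge set $E$, and let its dual lattice be its translate by $(\tfrac12,\tfrac12)$, so that every $e\in E$ is crossed by exactly one dual edge $e^\star$. Let $\omega\in\{0,1\}^E$ be a random edge configuration, identified with the spanning subgraph of $\mathbb Z^2$ formed by its open edges ($\omega(e)=1$), and let its dual $\omega^\star$ be the spanning subgraph of the dual lattice formed by the edges $e^\star$ with $\omega(e)=0$. Suppose that the law $\mathbb P$ of $\omega$ is invariant and ergodic under the group of all translations by vectors of $\mathbb Z^2$. Suppose further that at least one of the following holds: (A) almost surely, $\omega$ has finitely many infinite clusters (connected components), possibly none; (B) $\mathbb P$ is insertion tolerant and deletion tolerant, that is, for every edge $e$ and every event $A$ with $\mathbb P(A)>0$, the events $\{\omega\cup\{e\}:\omega\in A\}$ and $\{\omega\setminus\{e\}:\omega\in A\}$ have positive probability. Then almost surely there is no half-plane coexistence: at least one of $\omega$ and $\omega^\star$ has no infinite cluster when restricted to the closed upper half-plane $\{(x,y):y\ge 0\}$, where the restriction of a graph to the half-plane consists of its vertices and edges that are contained in the half-plane. -/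

import Mathlib

open MeasureTheory

namespace Z2

/-- An edge of the square lattice `ℤ²`, given by its lower-left endpoint `e.1` and its direction
`e.2`: horizontal for `false`, vertical for `true`. Every lattice edge has exactly one such code. -/
abbrev Edge : Type := (ℤ × ℤ) × Bool

/-- The left (for a vertical edge: lower) endpoint of an edge. -/
def src (e : Edge) : ℤ × ℤ := e.1

/-- The right (for a vertical edge: upper) endpoint of an edge. -/
def tgt (e : Edge) : ℤ × ℤ := e.1 + (if e.2 then (0, 1) else (1, 0))

/-- The vertex `(a, b)` of the dual lattice stands for the point `(a + 1/2, b + 1/2)` of the plane.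
The dual edge of the horizontal edge from `(a, b)` to `(a + 1, b)` joins the dual vertices
`(a + 1/2, b - 1/2)` and `(a + 1/2, b + 1/2)`; the dual edge of the vertical edge from `(a, b)` to
`(a, b + 1)` joins the dual vertices `(a - 1/2, b + 1/2)` and `(a + 1/2, b + 1/2)`. -/
def dualSrc (e : Edge) : ℤ × ℤ := e.1 - (if e.2 then (1, 0) else (0, 1))

/-- The upper (for a horizontal dual edge: right) endpoint of the dual edge of `e`. -/
def dualTgt (e : Edge) : ℤ × ℤ := e.1

/-- A percolation configuration `ω ∈ {0,1}^E`: the edge `e` is open if `ω e = true` and closed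
otherwise. It carries the product σ-algebra. -/
abbrev Config : Type := Edge → Bool

/-- The group `ℤ²` of translations acts on configurations: the edge `e` is open in `t +ᵥ ω` if and
only if its translate by `-t` is open in `ω`. -/
instance translation : AddAction (ℤ × ℤ) Config where
  vadd t ω := fun e => ω (e.1 - t, e.2)
  zero_vadd ω := by
    funext e
    change ω (e.1 - 0, e.2) = ω e
    rw [sub_zero]
  add_vadd s t ω := by
    funext e
    change ω (e.1 - (s + t), e.2) = ω (e.1 - s - t, e.2)
    rw [sub_sub]

/-- The spanning subgraph of `ℤ²` whose edges are the open edges. -/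
def primal (ω : Config) : SimpleGraph (ℤ × ℤ) :=
  SimpleGraph.fromEdgeSet {s | ∃ e : Edge, ω e = true ∧ s = s(src e, tgt e)}

/-- The dual of `ω`: the spanning subgraph of the dual lattice whose edges are the dual edges of the
closed edges. The vertex `(a, b)` stands for the point `(a + 1/2, b + 1/2)`. -/
def dual (ω : Config) : SimpleGraph (ℤ × ℤ) :=
  SimpleGraph.fromEdgeSet {s | ∃ e : Edge, ω e = false ∧ s = s(dualSrc e, dualTgt e)}

/-- The restriction of a subgraph of `ℤ²` (or of the dual lattice) to the closed upper half-plane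
`{(x, y) : y ≥ 0}`: all vertices in the half-plane and all edges contained in it. A dual vertex
`(a, b)`, that is the point `(a + 1/2, b + 1/2)`, lies in the half-plane if and only if
`0 ≤ b`, since `b` is an integer. -/
def upper (G : SimpleGraph (ℤ × ℤ)) : SimpleGraph {v : ℤ × ℤ // 0 ≤ v.2} :=
  G.induce {v : ℤ × ℤ | 0 ≤ v.2}

/-- The set of infinite clusters (infinite connected components) of a graph. -/
def infiniteClusters {V : Type} (G : SimpleGraph V) : Set G.ConnectedComponent :=
  {C | C.supp.Infinite}

/-- Some cluster of the graph is infinite. -/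
def HasInfiniteCluster {V : Type} (G : SimpleGraph V) : Prop :=
  (infiniteClusters G).Nonempty

/-- Half-plane coexistence: both the configuration and its dual have an infinite cluster when
restricted to the upper half-plane. -/
def HalfPlaneCoexistence (ω : Config) : Prop :=
  HasInfiniteCluster (upper (primal ω)) ∧ HasInfiniteCluster (upper (dual ω))

/-- Insertion tolerance: opening any one edge maps events of positive probability to events of
positive probability. -/
def InsertionTolerant (μ : Measure Config) : Prop :=
  ∀ (e : Edge) (A : Set Config), MeasurableSet A → 0 < μ A →
    0 < μ ((fun ω => Function.update ω e true) '' A)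

/-- Deletion tolerance: closing any one edge maps events of positive probability to events of
positive probability. -/
def DeletionTolerant (μ : Measure Config) : Prop :=
  ∀ (e : Edge) (A : Set Config), MeasurableSet A → 0 < μ A →
    0 < μ ((fun ω => Function.update ω e false) '' A)

end Z2

/-!
Half-plane coexistence is excluded by comparing the densities of clusters in half-planes of
different heights.

For a height `j`, remove from the half-plane `{y ≥ j}` the primal edges inside the row `y = j`. In
this *fringed* half-plane (`fringe`) the vertices of the row `j` are the ends of edges that stick
out of the half-plane above the dual row `j`. By planarity
(`not_inInfiniteCluster_dual_of_reachable`, proved by following the winding number of a primal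
path around the faces), a dual vertex of the row `j` in an infinite dual cluster separates the
primal vertices of the row on its left from those on its right.

Suppose that with positive probability infinite clusters of both types touch the boundary of the
fringed half-plane of height `0` (`BoundaryCoexistence`). By Poincaré recurrence in the horizontal
direction they do so arbitrarily far to the left and to the right, so there are infinitely many
infinite primal clusters on the boundary, each with a leftmost boundary vertex
(`exists_separated_sequence`, `exists_leftmost`). No two of them are connected in the whole plane.
Indeed, the expected number of infinite clusters of the fringed half-plane of height `-k` that
meet `[0, n) × {-k}` is independent of `k`. Up to an error `o(n)`, each of these clusters contains
an infinite cluster of the fringed half-plane of height `0` that meets `[0, n) × {0}`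
(`card_isFirst_le`). If clusters of the latter merged in the former with positive probability, the
number would drop by a positive density (`measureReal_leftmostMerges_eq_zero`).

So boundary coexistence forces infinitely many infinite primal clusters in the plane, which
contradicts the finiteness of their number. It also contradicts insertion tolerance, as opening
finitely many edges of the row `y = 0` merges two of the clusters and leaves the fringed
half-plane and its dual unchanged.

It remains to produce boundary coexistence from half-plane coexistence. By invariance all higher
half-planes have infinite clusters of both types as well, and the boundary below a lowest vertex
of an infinite dual cluster is touched by a dual cluster. If no infinite primal cluster touches
it, the infinite primal clusters above it are clusters of the whole plane; if this happens at
arbitrarily high boundaries, there are infinitely many (`infiniteClusters_primal_infinite`). Under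
insertion tolerance, opening a finite column of edges connects an infinite primal cluster to the
boundary (`ae_not_halfPlane_and_dualInf_of_insertionTolerant`).
-/

namespace Z2

open Filter

/-! ### Clusters of graphs -/

/-- The vertex `v` belongs to an infinite cluster of the graph `G`. -/
def InInfiniteCluster {V : Type*} (G : SimpleGraph V) (v : V) : Prop :=
  {w | G.Reachable v w}.Infinite

section Graph

variable {V : Type*} {G H : SimpleGraph V} {u v : V}

lemma InInfiniteCluster.mono (h : G ≤ H) (hv : InInfiniteCluster G v) : InInfiniteCluster H v :=
  Set.Infinite.mono (fun _ hw => SimpleGraph.Reachable.mono h hw) hv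

lemma InInfiniteCluster.of_reachable (h : G.Reachable u v) (hu : InInfiniteCluster G u) :
    InInfiniteCluster G v :=
  Set.Infinite.mono (fun _ hw => h.symm.trans hw) hu

/-- A property that is preserved along edges holds on the whole cluster. -/
lemma reachable_induction {P : V → Prop} (h0 : P u)
    (step : ∀ x y, G.Reachable u x → G.Adj x y → P x → P y) (h : G.Reachable u v) : P v := by
  rw [SimpleGraph.reachable_iff_reflTransGen] at h
  induction h with
  | refl => exact h0
  | tail hab hbc ih =>
    exact step _ _ ((SimpleGraph.reachable_iff_reflTransGen _ _).2 hab) hbc ih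

/-- An infinite cluster leaves every finite set through one of its edges. -/
lemma InInfiniteCluster.exists_adj_exit {S : Set V} (hS : S.Finite) (huS : u ∈ S)
    (hu : InInfiniteCluster G u) :
    ∃ x ∈ S, ∃ y ∉ S, G.Reachable u x ∧ G.Adj x y := by
  by_contra! hcon
  refine hu (hS.subset fun w hw => ?_)
  refine reachable_induction (P := fun w => w ∈ S) huS (fun x y hx hxy hxS => ?_) hw
  by_contra hy
  exact hcon x hxS y hy hx hxy

/-- Removing edges at finitely many vertices from a graph with infinitely many vertices in infinite
clusters leaves at least one vertex in an infinite cluster. -/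
lemma exists_inInfiniteCluster_of_finite_change {F T : Set V} (hF : F.Finite) (hT : T.Infinite)
    (hTG : ∀ t ∈ T, InInfiniteCluster G t) (hGH : ∀ x y, x ∉ F → G.Adj x y → H.Adj x y) :
    ∃ t ∈ T, InInfiniteCluster H t := by
  by_contra! hcon
  refine hT (Set.Finite.subset (s := ⋃ f ∈ {f ∈ F | ¬ InInfiniteCluster H f},
    {w | H.Reachable f w}) ?_ fun t ht => ?_)
  · exact (hF.subset (Set.sep_subset _ _)).biUnion fun f hf => Set.not_infinite.1 hf.2
  · by_contra hnot
    simp only [Set.mem_iUnion, not_exists] at hnot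
    -- The `H`-cluster of `t` avoids `F`, hence it is also the `G`-cluster of `t`.
    refine hcon t ht (Set.Infinite.mono (fun w hw => ?_) (hTG t ht))
    refine reachable_induction (P := fun w => H.Reachable t w) .rfl (fun x y _ hxy hx => ?_) hw
    refine hx.trans (hGH x y (fun hxF => ?_) hxy).reachable
    exact hnot x ⟨hxF, fun hxi => hcon t ht (hxi.of_reachable hx.symm)⟩ hx.symm

/-- The clusters of infinitely many pairwise disconnected vertices in infinite clusters are
infinitely many infinite clusters. -/
lemma infiniteClusters_infinite {V : Type} {G : SimpleGraph V} (f : ℕ → V)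
    (hf : ∀ n, InInfiniteCluster G (f n)) (hne : ∀ m n, m < n → ¬ G.Reachable (f m) (f n)) :
    (infiniteClusters G).Infinite := by
  refine Set.infinite_of_injective_forall_mem (f := fun n => G.connectedComponentMk (f n)) ?_ ?_
  · intro m n hmn
    have h : G.Reachable (f m) (f n) := SimpleGraph.ConnectedComponent.exact hmn
    rcases lt_trichotomy m n with h1 | h1 | h1
    · exact absurd h (hne m n h1)
    · exact h1
    · exact absurd h.symm (hne n m h1)
  · intro n
    refine Set.Infinite.mono (fun w hw => ?_) (hf n)
    exact (SimpleGraph.ConnectedComponent.sound (SimpleGraph.Reachable.symm hw))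

/-- A vertex in an infinite cluster of a graph whose infinite clusters are finitely many lies in
one of the clusters of a fixed finite set of vertices. -/
lemma exists_finite_representatives {V : Type} {G : SimpleGraph V}
    (h : (infiniteClusters G).Finite) :
    ∃ R : Set V, R.Finite ∧ ∀ v, InInfiniteCluster G v → ∃ r ∈ R, G.Reachable v r := by
  refine ⟨Quot.out '' infiniteClusters G, h.image _, fun v hv => ?_⟩
  refine ⟨Quot.out (G.connectedComponentMk v), ⟨_, ?_, rfl⟩, ?_⟩
  · refine Set.Infinite.mono (fun w hw => ?_) hv
    exact (SimpleGraph.ConnectedComponent.sound (SimpleGraph.Reachable.symm hw))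
  · exact SimpleGraph.ConnectedComponent.exact (Quot.out_eq (G.connectedComponentMk v)).symm

end Graph

/-! ### Half-planes and fringed half-planes -/

/-- The restriction of a graph to the half-plane `{y ≥ j}`, as a spanning subgraph of the lattice:
the vertices below height `j` are isolated. -/
def halfPlane (G : SimpleGraph (ℤ × ℤ)) (j : ℤ) : SimpleGraph (ℤ × ℤ) where
  Adj u v := G.Adj u v ∧ j ≤ u.2 ∧ j ≤ v.2
  symm := ⟨fun _ _ h => ⟨h.1.symm, h.2.2, h.2.1⟩⟩
  loopless := ⟨fun _ h => h.1.ne rfl⟩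

/-- The restriction of a graph to the half-plane `{y ≥ j}` without the edges inside the row `y = j`.
The vertices of that row have degree at most one. For the primal lattice this is the
restriction to the half-plane above the height `j + 1/2` of the dual row `j`, together
with the edges that stick out of it. -/
def fringe (G : SimpleGraph (ℤ × ℤ)) (j : ℤ) : SimpleGraph (ℤ × ℤ) where
  Adj u v := G.Adj u v ∧ j ≤ u.2 ∧ j ≤ v.2 ∧ (j < u.2 ∨ j < v.2)
  symm := ⟨fun _ _ h => ⟨h.1.symm, h.2.2.1, h.2.1, h.2.2.2.symm⟩⟩
  loopless := ⟨fun _ h => h.1.ne rfl⟩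

lemma halfPlane_anti (G : SimpleGraph (ℤ × ℤ)) {i j : ℤ} (h : i ≤ j) :
    halfPlane G j ≤ halfPlane G i := fun _ _ hab => ⟨hab.1, h.trans hab.2.1, h.trans hab.2.2⟩

lemma fringe_anti (G : SimpleGraph (ℤ × ℤ)) {i j : ℤ} (h : i ≤ j) : fringe G j ≤ fringe G i :=
  fun _ _ hab => ⟨hab.1, h.trans hab.2.1, h.trans hab.2.2.1, hab.2.2.2.imp h.trans_lt h.trans_lt⟩

lemma fringe_le (G : SimpleGraph (ℤ × ℤ)) (j : ℤ) : fringe G j ≤ G := fun _ _ h => h.1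

lemma halfPlane_le_fringe (G : SimpleGraph (ℤ × ℤ)) (j : ℤ) :
    halfPlane G (j + 1) ≤ fringe G j := fun _ _ h =>
  ⟨h.1, by have := h.2.1; omega, by have := h.2.2; omega, Or.inl (by have := h.2.1; omega)⟩

lemma le_of_inInfiniteCluster_halfPlane {G : SimpleGraph (ℤ × ℤ)} {j : ℤ} {v : ℤ × ℤ}
    (h : InInfiniteCluster (halfPlane G j) v) : j ≤ v.2 := by
  obtain ⟨x, hx, y, -, -, hxy⟩ := h.exists_adj_exit (Set.finite_singleton v) rfl
  obtain rfl : x = v := hx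
  exact hxy.2.1

/-- An infinite cluster of a half-plane, seen from one of its lowest vertices. -/
lemma exists_lowest {G : SimpleGraph (ℤ × ℤ)} {j : ℤ} {v : ℤ × ℤ}
    (h : InInfiniteCluster (halfPlane G j) v) :
    ∃ w : ℤ × ℤ, j ≤ w.2 ∧ InInfiniteCluster (halfPlane G w.2) w := by
  classical
  have hge : ∀ w, (halfPlane G j).Reachable v w → j ≤ w.2 := fun w hw =>
    le_of_inInfiniteCluster_halfPlane (h.of_reachable hw)
  obtain ⟨r, ⟨w, hw, rfl⟩, hr⟩ := Int.exists_least_of_bdd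
    (P := fun r => ∃ w : ℤ × ℤ, (halfPlane G j).Reachable v w ∧ w.2 = r)
    ⟨j, by rintro _ ⟨w, hw, rfl⟩; exact hge w hw⟩ ⟨v.2, v, .rfl, rfl⟩
  refine ⟨w, hge w hw, Set.Infinite.mono (fun z hz => ?_) (h.of_reachable hw)⟩
  refine reachable_induction (P := fun z => (halfPlane G w.2).Reachable w z) .rfl
    (fun x y hx hxy ih => ?_) hz
  refine ih.trans (SimpleGraph.Adj.reachable ⟨hxy.1, hr _ ⟨x, hw.trans hx, rfl⟩,
    hr _ ⟨y, (hw.trans hx).trans hxy.reachable, rfl⟩⟩)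

lemma exists_inInfiniteCluster_of_upper {G : SimpleGraph (ℤ × ℤ)}
    (h : HasInfiniteCluster (upper G)) : ∃ v, InInfiniteCluster (halfPlane G 0) v := by
  obtain ⟨C, hC⟩ := h
  induction C using SimpleGraph.ConnectedComponent.ind with | _ v => ?_
  refine ⟨v.1, Set.Infinite.mono (s := Subtype.val '' _) ?_
    (Set.Infinite.image Subtype.val_injective.injOn hC)⟩
  rintro _ ⟨w, hw, rfl⟩
  have hvw : (upper G).Reachable v w := (SimpleGraph.ConnectedComponent.exact hw).symm
  exact reachable_induction (P := fun w => (halfPlane G 0).Reachable v.1 w.1) .rfl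
    (fun x y _ hxy ih => ih.trans (SimpleGraph.Adj.reachable ⟨hxy, x.2, y.2⟩)) hvw

/-- Two vertices that are connected in a graph are connected in every low enough half-plane. -/
lemma exists_fringe_reachable {G : SimpleGraph (ℤ × ℤ)} {u v : ℤ × ℤ} (h : G.Reachable u v) :
    ∃ k : ℕ, (fringe G (-k)).Reachable u v := by
  refine reachable_induction (P := fun v => ∃ k : ℕ, (fringe G (-k)).Reachable u v)
    ⟨0, .rfl⟩ ?_ h
  rintro x y - hxy ⟨k, hk⟩
  refine ⟨k + x.2.natAbs + y.2.natAbs + 1, SimpleGraph.Reachable.trans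
    (hk.mono (fringe_anti G (by omega))) (SimpleGraph.Adj.reachable ?_)⟩
  exact ⟨hxy, by omega, by omega, Or.inl (by omega)⟩

/-! ### Edges of the configuration and of its dual -/

lemma primal_adj {ω : Config} {u v : ℤ × ℤ} : (primal ω).Adj u v ↔
    (∃ x y, ω ((x, y), false) = true ∧
      (u = (x, y) ∧ v = (x + 1, y) ∨ u = (x + 1, y) ∧ v = (x, y))) ∨
    (∃ x y, ω ((x, y), true) = true ∧
      (u = (x, y) ∧ v = (x, y + 1) ∨ u = (x, y + 1) ∧ v = (x, y))) := by
  simp only [primal, SimpleGraph.fromEdgeSet_adj, Set.mem_ofPred_eq, src, tgt]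
  constructor
  · rintro ⟨⟨⟨⟨x, y⟩, d⟩, he, h⟩, -⟩
    rw [Sym2.eq_iff] at h
    cases d
    · exact Or.inl ⟨x, y, he, by simpa using h⟩
    · exact Or.inr ⟨x, y, he, by simpa using h⟩
  · rintro (⟨x, y, he, h⟩ | ⟨x, y, he, h⟩)
    · refine ⟨⟨((x, y), false), he, ?_⟩, ?_⟩
      · rw [Sym2.eq_iff]; simpa using h
      · rcases h with ⟨rfl, rfl⟩ | ⟨rfl, rfl⟩ <;> simp
    · refine ⟨⟨((x, y), true), he, ?_⟩, ?_⟩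
      · rw [Sym2.eq_iff]; simpa using h
      · rcases h with ⟨rfl, rfl⟩ | ⟨rfl, rfl⟩ <;> simp

lemma dual_adj {ω : Config} {u v : ℤ × ℤ} : (dual ω).Adj u v ↔
    (∃ x y, ω ((x, y), false) = false ∧
      (u = (x, y - 1) ∧ v = (x, y) ∨ u = (x, y) ∧ v = (x, y - 1))) ∨
    (∃ x y, ω ((x, y), true) = false ∧
      (u = (x - 1, y) ∧ v = (x, y) ∨ u = (x, y) ∧ v = (x - 1, y))) := by
  simp only [dual, SimpleGraph.fromEdgeSet_adj, Set.mem_ofPred_eq, dualSrc, dualTgt]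
  constructor
  · rintro ⟨⟨⟨⟨x, y⟩, d⟩, he, h⟩, -⟩
    rw [Sym2.eq_iff] at h
    cases d
    · exact Or.inl ⟨x, y, he, by simpa using h⟩
    · exact Or.inr ⟨x, y, he, by simpa using h⟩
  · rintro (⟨x, y, he, h⟩ | ⟨x, y, he, h⟩)
    · refine ⟨⟨((x, y), false), he, ?_⟩, ?_⟩
      · rw [Sym2.eq_iff]; simpa using h
      · rw [ne_eq, Prod.ext_iff]
        rcases h with ⟨rfl, rfl⟩ | ⟨rfl, rfl⟩ <;> dsimp only <;> omega
    · refine ⟨⟨((x, y), true), he, ?_⟩, ?_⟩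
      · rw [Sym2.eq_iff]; simpa using h
      · rw [ne_eq, Prod.ext_iff]
        rcases h with ⟨rfl, rfl⟩ | ⟨rfl, rfl⟩ <;> dsimp only <;> omega

/-! ### Planarity -/

/-- The indicator of a proposition, as an integer. -/
noncomputable def ind (p : Prop) : ℤ := open Classical in if p then 1 else 0

/-- The potential of a path in the fringed half-plane of height `0`. The value `φ f` is the signed
number of crossings of the path with the vertical ray going up from the face `f`. It changes only
across edges of the path, apart from the jumps caused by the endpoints, and on the bottom
row of faces it is given by the endpoints alone. -/
lemma exists_potential {ω : Config} {s u : ℤ × ℤ} (h : (fringe (primal ω) 0).Reachable s u) :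
    ∃ φ : ℤ → ℤ → ℤ, {f : ℤ × ℤ | φ f.1 f.2 ≠ 0 ∧ 0 ≤ f.2}.Finite ∧
      (∀ x, φ x 0 = ind (s.1 ≤ x) - ind (u.1 ≤ x)) ∧
      (∀ x y, 1 ≤ y → ω ((x, y), false) = false → φ x (y - 1) = φ x y) ∧
      (∀ x y, 0 ≤ y → ω ((x, y), true) = false →
        φ (x - 1) y - φ x y = ind (u.1 = x ∧ y < u.2) - ind (s.1 = x ∧ y < s.2)) := by
  refine reachable_induction (P := fun u => ∃ φ : ℤ → ℤ → ℤ,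
      {f : ℤ × ℤ | φ f.1 f.2 ≠ 0 ∧ 0 ≤ f.2}.Finite ∧
      (∀ x, φ x 0 = ind (s.1 ≤ x) - ind (u.1 ≤ x)) ∧
      (∀ x y, 1 ≤ y → ω ((x, y), false) = false → φ x (y - 1) = φ x y) ∧
      (∀ x y, 0 ≤ y → ω ((x, y), true) = false →
        φ (x - 1) y - φ x y = ind (u.1 = x ∧ y < u.2) - ind (s.1 = x ∧ y < s.2)))
    ⟨fun _ _ => 0, by simp, by simp, by simp, by simp⟩ ?_ h
  rintro p q - ⟨hpq, hp0, hq0, hpos⟩ ⟨φ, hfin, hrow, hhor, hver⟩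
  rcases primal_adj.1 hpq with ⟨a, b, ho, hab⟩ | ⟨a, b, ho, hab⟩
  · -- A horizontal step changes the potential below it, by its sign.
    obtain ⟨ε, hε⟩ : ∃ ε : ℤ, ∀ x, ind (p.1 ≤ x) - ind (q.1 ≤ x) = ε * ind (x = a) ∧
        ∀ y, ind (q.1 = x ∧ y < b) - ind (p.1 = x ∧ y < b) =
          ε * ind (x - 1 = a ∧ y < b) - ε * ind (x = a ∧ y < b) := by
      rcases hab with ⟨rfl, rfl⟩ | ⟨rfl, rfl⟩
      · refine ⟨1, fun x => ⟨?_, fun y => ?_⟩⟩ <;> simp only [ind] <;> split_ifs <;> omega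
      · refine ⟨-1, fun x => ⟨?_, fun y => ?_⟩⟩ <;> simp only [ind] <;> split_ifs <;> omega
    have hp2 : p.2 = b := by rcases hab with ⟨rfl, rfl⟩ | ⟨rfl, rfl⟩ <;> rfl
    have hq2 : q.2 = b := by rcases hab with ⟨rfl, rfl⟩ | ⟨rfl, rfl⟩ <;> rfl
    have hb : 0 < b := by omega
    refine ⟨fun x y => φ x y + ε * ind (x = a ∧ y < b), ?_, fun x => ?_, fun x y hy he => ?_,
      fun x y hy he => ?_⟩
    · refine (hfin.union ((Set.finite_singleton a).prod (Set.finite_Icc 0 b))).subset ?_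
      rintro ⟨x, y⟩ ⟨hne, hy⟩
      by_cases hxy : x = a ∧ y < b
      · right
        obtain ⟨rfl, hyb⟩ := hxy
        exact ⟨rfl, hy, hyb.le⟩
      · left
        simp only [ind, hxy, if_false, mul_zero, add_zero] at hne
        exact ⟨hne, hy⟩
    · have := (hε x).1
      have h2 : ind (x = a ∧ 0 < b) = ind (x = a) := by simp [ind, hb]
      simp only [hrow, h2]
      linarith
    · have hne : ¬ (x = a ∧ y = b) := by
        rintro ⟨rfl, rfl⟩
        simp [ho] at he
      have h2 : ind (x = a ∧ y - 1 < b) = ind (x = a ∧ y < b) := by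
        congr 1
        exact propext ⟨fun h => ⟨h.1, by omega⟩, fun h => ⟨h.1, by omega⟩⟩
      simp only [hhor x y hy he, h2]
    · have h1 := hver x y hy he
      have h2 := (hε x).2 y
      rw [hp2] at h1
      rw [hq2]
      simp only
      linarith
  · -- A vertical step does not change the potential.
    refine ⟨φ, hfin, fun x => ?_, hhor, fun x y hy he => ?_⟩
    · rw [hrow]
      rcases hab with ⟨rfl, rfl⟩ | ⟨rfl, rfl⟩ <;> rfl
    · rw [hver x y hy he]
      have hne : ¬ (x = a ∧ y = b) := by
        rintro ⟨rfl, rfl⟩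
        simp [ho] at he
      congr 2
      rcases hab with ⟨rfl, rfl⟩ | ⟨rfl, rfl⟩
      · exact propext ⟨fun h => ⟨h.1, by omega⟩, fun h => ⟨h.1, by omega⟩⟩
      · exact propext ⟨fun h => ⟨h.1, by omega⟩, fun h => ⟨h.1, by omega⟩⟩

/-- Planarity: a primal path between two points of the bottom row encloses the dual vertices between
them, so their dual clusters in the half-plane are finite. -/
lemma not_inInfiniteCluster_dual_of_reachable {ω : Config} {a b c : ℤ} (hab : a ≤ b) (hbc : b < c)
    (h : (fringe (primal ω) 0).Reachable (a, 0) (c, 0)) :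
    ¬ InInfiniteCluster (halfPlane (dual ω) 0) (b, 0) := by
  obtain ⟨φ, hfin, hrow, hhor, hver⟩ := exists_potential h
  refine Set.not_infinite.2 (hfin.subset fun w hw => ?_)
  have key : φ w.1 w.2 = 1 ∧ 0 ≤ w.2 := by
    refine reachable_induction (P := fun w => φ w.1 w.2 = 1 ∧ 0 ≤ w.2) ?_ ?_ hw
    · refine ⟨?_, le_rfl⟩
      rw [hrow]
      simp [ind, hab, hbc]
    · rintro p q - ⟨hpq, hp0, hq0⟩ ⟨hp, -⟩
      refine ⟨?_, hq0⟩
      rcases dual_adj.1 hpq with ⟨x, y, he, ⟨rfl, rfl⟩ | ⟨rfl, rfl⟩⟩ |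
        ⟨x, y, he, ⟨rfl, rfl⟩ | ⟨rfl, rfl⟩⟩
      · rw [← hp, hhor x y (by simp at hp0; omega) he]
      · exact (hhor x y (by simp at hq0; omega) he).trans hp
      · have := hver x y hp0 he
        simp only [ind, hp0.not_gt, and_false, if_false] at this hp ⊢
        linarith
      · have := hver x y hp0 he
        simp only [ind, hp0.not_gt, and_false, if_false] at this hp ⊢
        linarith
  exact ⟨by rw [key.1]; exact one_ne_zero, key.2⟩

/-! ### Measurability -/

section Measurability

variable {Ω V : Type*} [MeasurableSpace Ω] [Countable V] {G : Ω → SimpleGraph V}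

lemma measurableSet_reachable (hG : ∀ u v, MeasurableSet {ω | (G ω).Adj u v}) (u v : V) :
    MeasurableSet {ω | (G ω).Reachable u v} := by
  have hwalk : ∀ (n : ℕ) (u v : V), MeasurableSet {ω | ∃ p : (G ω).Walk u v, p.length = n} := by
    intro n
    induction n with
    | zero =>
      intro u v
      by_cases huv : u = v
      · subst huv
        have hfull : ∀ ω, ∃ p : (G ω).Walk u u, p.length = 0 := fun ω => ⟨.nil, rfl⟩
        simp only [hfull, MeasurableSet.const]
      · have hempty : ∀ ω, ¬ ∃ p : (G ω).Walk u v, p.length = 0 :=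
          fun ω h => huv (SimpleGraph.Walk.eq_of_length_eq_zero h.choose_spec)
        simp only [hempty, MeasurableSet.const]
    | succ n ih =>
      intro u v
      have : {ω | ∃ p : (G ω).Walk u v, p.length = n + 1} =
          ⋃ w, {ω | (G ω).Adj u w} ∩ {ω | ∃ p : (G ω).Walk w v, p.length = n} := by
        ext ω
        simp only [Set.mem_iUnion]
        constructor
        · rintro ⟨p, hp⟩
          cases p with
          | nil => simp at hp
          | cons h p => exact ⟨_, h, p, by simpa using hp⟩
        · rintro ⟨w, h, p, hp⟩
          exact ⟨.cons h p, by simpa using hp⟩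
      rw [this]
      exact MeasurableSet.iUnion fun w => (hG u w).inter (ih w v)
  have : {ω | (G ω).Reachable u v} = ⋃ n, {ω | ∃ p : (G ω).Walk u v, p.length = n} := by
    ext ω
    simp only [Set.mem_iUnion]
    exact ⟨fun ⟨p⟩ => ⟨_, p, rfl⟩, fun ⟨_, p, _⟩ => ⟨p⟩⟩
  rw [this]
  exact MeasurableSet.iUnion fun n => hwalk n u v

lemma measurableSet_inInfiniteCluster (hG : ∀ u v, MeasurableSet {ω | (G ω).Adj u v}) (v : V) :
    MeasurableSet {ω | InInfiniteCluster (G ω) v} := by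
  have : {ω | InInfiniteCluster (G ω) v} =
      ⋂ s : Finset V, ⋃ w ∈ {w | w ∉ s}, {ω | (G ω).Reachable v w} := by
    ext ω
    simp only [Set.mem_iInter, Set.mem_iUnion]
    constructor
    · intro h s
      obtain ⟨w, hw, hws⟩ := Set.Infinite.exists_notMem_finset h s
      exact ⟨w, hws, hw⟩
    · intro h hfin
      obtain ⟨w, hw, hvw⟩ := h hfin.toFinset
      exact hw (hfin.mem_toFinset.2 hvw)
  rw [this]
  exact MeasurableSet.iInter fun s => MeasurableSet.biUnion (Set.to_countable _)
    fun w _ => measurableSet_reachable hG v w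

end Measurability

lemma measurableSet_edge (e : Edge) (b : Bool) : MeasurableSet {ω : Config | ω e = b} :=
  (measurable_pi_apply (X := fun _ : Edge => Bool) e) (measurableSet_singleton b)

lemma measurableSet_primal_adj (u v : ℤ × ℤ) : MeasurableSet {ω : Config | (primal ω).Adj u v} := by
  have : {ω : Config | (primal ω).Adj u v} =
      ⋃ e ∈ {e : Edge | s(u, v) = s(src e, tgt e) ∧ u ≠ v}, {ω : Config | ω e = true} := by
    ext ω
    simp only [Set.mem_iUnion, primal, SimpleGraph.fromEdgeSet_adj, Set.mem_ofPred_eq]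
    exact ⟨fun ⟨⟨e, h, h'⟩, hne⟩ => ⟨e, ⟨h', hne⟩, h⟩, fun ⟨e, ⟨h', hne⟩, h⟩ => ⟨⟨e, h, h'⟩, hne⟩⟩
  rw [this]
  exact MeasurableSet.biUnion (Set.to_countable _) fun e _ => measurableSet_edge e true

lemma measurableSet_dual_adj (u v : ℤ × ℤ) : MeasurableSet {ω : Config | (dual ω).Adj u v} := by
  have : {ω : Config | (dual ω).Adj u v} =
      ⋃ e ∈ {e : Edge | s(u, v) = s(dualSrc e, dualTgt e) ∧ u ≠ v},
        {ω : Config | ω e = false} := by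
    ext ω
    simp only [Set.mem_iUnion, dual, SimpleGraph.fromEdgeSet_adj, Set.mem_ofPred_eq]
    exact ⟨fun ⟨⟨e, h, h'⟩, hne⟩ => ⟨e, ⟨h', hne⟩, h⟩, fun ⟨e, ⟨h', hne⟩, h⟩ => ⟨⟨e, h, h'⟩, hne⟩⟩
  rw [this]
  exact MeasurableSet.biUnion (Set.to_countable _) fun e _ => measurableSet_edge e false

lemma measurableSet_and_const {Ω : Type*} [MeasurableSpace Ω] {p : Ω → Prop}
    (hp : MeasurableSet {ω | p ω}) (q : Prop) : MeasurableSet {ω | p ω ∧ q} :=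
  hp.inter (MeasurableSet.const q)

lemma measurableSet_fringe_adj (j : ℤ) (u v : ℤ × ℤ) :
    MeasurableSet {ω : Config | (fringe (primal ω) j).Adj u v} :=
  measurableSet_and_const (measurableSet_primal_adj u v) _

lemma measurableSet_halfPlane_primal_adj (j : ℤ) (u v : ℤ × ℤ) :
    MeasurableSet {ω : Config | (halfPlane (primal ω) j).Adj u v} :=
  measurableSet_and_const (measurableSet_primal_adj u v) _

lemma measurableSet_halfPlane_dual_adj (j : ℤ) (u v : ℤ × ℤ) :
    MeasurableSet {ω : Config | (halfPlane (dual ω) j).Adj u v} :=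
  measurableSet_and_const (measurableSet_dual_adj u v) _

/-! ### Translations -/

lemma vadd_apply (t : ℤ × ℤ) (ω : Config) (e : Edge) : (t +ᵥ ω) e = ω (e.1 - t, e.2) := rfl

lemma reachable_of_adj_imp {V W : Type*} {G : SimpleGraph V} {H : SimpleGraph W} (f : V → W)
    (h : ∀ u v, G.Adj u v → H.Adj (f u) (f v)) {u v : V} (huv : G.Reachable u v) :
    H.Reachable (f u) (f v) :=
  reachable_induction (P := fun v => H.Reachable (f u) (f v)) .rfl
    (fun x y _ hxy ih => ih.trans (h x y hxy).reachable) huv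

section Shift

variable {G H : SimpleGraph (ℤ × ℤ)} {t : ℤ × ℤ}

lemma reachable_shift (h : ∀ u v, G.Adj u v ↔ H.Adj (u - t) (v - t)) (u v : ℤ × ℤ) :
    G.Reachable u v ↔ H.Reachable (u - t) (v - t) := by
  refine ⟨reachable_of_adj_imp (· - t) fun u v => (h u v).1, fun huv => ?_⟩
  have := reachable_of_adj_imp (· + t) (fun u v huv => (h (u + t) (v + t)).2 (by simpa using huv))
    huv
  simpa using this

lemma inInfiniteCluster_shift (h : ∀ u v, G.Adj u v ↔ H.Adj (u - t) (v - t)) (v : ℤ × ℤ) :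
    InInfiniteCluster G v ↔ InInfiniteCluster H (v - t) := by
  have : {w | G.Reachable v w} = (fun w => w - t) ⁻¹' {w | H.Reachable (v - t) w} := by
    ext w
    exact reachable_shift h v w
  rw [InInfiniteCluster, this, InInfiniteCluster]
  constructor
  · intro hinf hfin
    exact hinf (hfin.preimage (sub_left_injective.injOn))
  · intro hinf
    exact hinf.preimage fun w _ => ⟨w + t, by simp⟩

lemma exists_inInfiniteCluster_shift (h : ∀ u v, G.Adj u v ↔ H.Adj (u - t) (v - t)) :
    (∃ v, InInfiniteCluster G v) ↔ ∃ v, InInfiniteCluster H v :=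
  ⟨fun ⟨v, hv⟩ => ⟨v - t, (inInfiniteCluster_shift h v).1 hv⟩,
    fun ⟨v, hv⟩ => ⟨v + t, (inInfiniteCluster_shift h _).2 (by simpa using hv)⟩⟩

end Shift

lemma primal_vadd_adj (t : ℤ × ℤ) (ω : Config) (u v : ℤ × ℤ) :
    (primal (t +ᵥ ω)).Adj u v ↔ (primal ω).Adj (u - t) (v - t) := by
  obtain ⟨s, t⟩ := t
  obtain ⟨a, b⟩ := u
  obtain ⟨c, d⟩ := v
  simp only [primal_adj, vadd_apply, Prod.mk_sub_mk, Prod.mk.injEq]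
  constructor
  · rintro (⟨x, y, h, h'⟩ | ⟨x, y, h, h'⟩)
    · exact Or.inl ⟨x - s, y - t, h, by omega⟩
    · exact Or.inr ⟨x - s, y - t, h, by omega⟩
  · rintro (⟨x, y, h, h'⟩ | ⟨x, y, h, h'⟩)
    · exact Or.inl ⟨x + s, y + t, by simpa using h, by omega⟩
    · exact Or.inr ⟨x + s, y + t, by simpa using h, by omega⟩

lemma dual_vadd_adj (t : ℤ × ℤ) (ω : Config) (u v : ℤ × ℤ) :
    (dual (t +ᵥ ω)).Adj u v ↔ (dual ω).Adj (u - t) (v - t) := by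
  obtain ⟨s, t⟩ := t
  obtain ⟨a, b⟩ := u
  obtain ⟨c, d⟩ := v
  simp only [dual_adj, vadd_apply, Prod.mk_sub_mk, Prod.mk.injEq]
  constructor
  · rintro (⟨x, y, h, h'⟩ | ⟨x, y, h, h'⟩)
    · exact Or.inl ⟨x - s, y - t, h, by omega⟩
    · exact Or.inr ⟨x - s, y - t, h, by omega⟩
  · rintro (⟨x, y, h, h'⟩ | ⟨x, y, h, h'⟩)
    · exact Or.inl ⟨x + s, y + t, by simpa using h, by omega⟩
    · exact Or.inr ⟨x + s, y + t, by simpa using h, by omega⟩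

lemma fringe_vadd_adj (t : ℤ × ℤ) (ω : Config) (j : ℤ) (u v : ℤ × ℤ) :
    (fringe (primal (t +ᵥ ω)) j).Adj u v ↔ (fringe (primal ω) (j - t.2)).Adj (u - t) (v - t) := by
  simp only [fringe, primal_vadd_adj, Prod.snd_sub, sub_le_sub_iff_right, sub_lt_sub_iff_right]

lemma halfPlane_primal_vadd_adj (t : ℤ × ℤ) (ω : Config) (j : ℤ) (u v : ℤ × ℤ) :
    (halfPlane (primal (t +ᵥ ω)) j).Adj u v ↔
      (halfPlane (primal ω) (j - t.2)).Adj (u - t) (v - t) := by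
  simp only [halfPlane, primal_vadd_adj, Prod.snd_sub, sub_le_sub_iff_right]

lemma halfPlane_dual_vadd_adj (t : ℤ × ℤ) (ω : Config) (j : ℤ) (u v : ℤ × ℤ) :
    (halfPlane (dual (t +ᵥ ω)) j).Adj u v ↔
      (halfPlane (dual ω) (j - t.2)).Adj (u - t) (v - t) := by
  simp only [halfPlane, dual_vadd_adj, Prod.snd_sub, sub_le_sub_iff_right]

/-- The vertex `(x, j)` is connected to infinity in the fringed half-plane of height `j`. -/
def PrimalInf (j x : ℤ) (ω : Config) : Prop := InInfiniteCluster (fringe (primal ω) j) (x, j)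

/-- The dual vertex `(x, j)` is connected to infinity in the dual half-plane of height `j`. -/
def DualInf (j x : ℤ) (ω : Config) : Prop := InInfiniteCluster (halfPlane (dual ω) j) (x, j)

lemma primalInf_vadd (j x : ℤ) (t : ℤ × ℤ) (ω : Config) :
    PrimalInf j x (t +ᵥ ω) ↔ PrimalInf (j - t.2) (x - t.1) ω :=
  inInfiniteCluster_shift (fringe_vadd_adj t ω j) (x, j)

lemma dualInf_vadd (j x : ℤ) (t : ℤ × ℤ) (ω : Config) :
    DualInf j x (t +ᵥ ω) ↔ DualInf (j - t.2) (x - t.1) ω :=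
  inInfiniteCluster_shift (halfPlane_dual_vadd_adj t ω j) (x, j)

lemma fringe_reachable_vadd (j : ℤ) (t : ℤ × ℤ) (ω : Config) (u v : ℤ × ℤ) :
    (fringe (primal (t +ᵥ ω)) j).Reachable u v ↔
      (fringe (primal ω) (j - t.2)).Reachable (u - t) (v - t) :=
  reachable_shift (fringe_vadd_adj t ω j) u v

lemma measurableSet_primalInf (j x : ℤ) : MeasurableSet {ω | PrimalInf j x ω} :=
  measurableSet_inInfiniteCluster (measurableSet_fringe_adj j) _

lemma measurableSet_dualInf (j x : ℤ) : MeasurableSet {ω | DualInf j x ω} :=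
  measurableSet_inInfiniteCluster (measurableSet_halfPlane_dual_adj j) _

lemma measurableSet_fringe_reachable (j : ℤ) (u v : ℤ × ℤ) :
    MeasurableSet {ω : Config | (fringe (primal ω) j).Reachable u v} :=
  measurableSet_reachable (measurableSet_fringe_adj j) u v

section Invariance

variable {μ : Measure Config} [VAddInvariantMeasure (ℤ × ℤ) Config μ]

lemma measurable_translation (t : ℤ × ℤ) : Measurable fun ω : Config => t +ᵥ ω :=
  measurable_pi_lambda _ fun e => measurable_pi_apply (e.1 - t, e.2)

variable (μ) in
lemma measurePreserving_translation (t : ℤ × ℤ) :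
    MeasurePreserving (fun ω : Config => t +ᵥ ω) μ μ :=
  ⟨measurable_translation t, Measure.ext fun s hs => by
    rw [Measure.map_apply (measurable_translation t) hs]
    exact VAddInvariantMeasure.measure_preimage_vadd t hs⟩

lemma ae_translate {p : Config → Prop} (h : ∀ᵐ ω ∂μ, p ω) (t : ℤ × ℤ) : ∀ᵐ ω ∂μ, p (t +ᵥ ω) :=
  (measurePreserving_translation μ t).quasiMeasurePreserving.ae h

/-- Poincaré recurrence in the direction `±1`. -/
lemma ae_recurrence_direction [IsFiniteMeasure μ] {A : Set Config} (hA : MeasurableSet A) (d : ℤ) :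
    ∀ᵐ ω ∂μ, ∀ x : ℤ, ((-x, 0) : ℤ × ℤ) +ᵥ ω ∈ A →
      ∀ N : ℕ, ∃ n ≥ N, ((-(x + n * d), 0) : ℤ × ℤ) +ᵥ ω ∈ A := by
  have h := (measurePreserving_translation μ (-d, 0)).conservative.ae_mem_imp_frequently_image_mem
    hA.nullMeasurableSet
  refine ae_all_iff.2 fun x => (ae_translate h (-x, 0)).mono fun ω hω hx N => ?_
  obtain ⟨n, hn, hnA⟩ := frequently_atTop.1 (hω hx) N
  refine ⟨n, hn, ?_⟩
  rw [vadd_iterate] at hnA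
  simp only [vadd_vadd] at hnA
  convert hnA using 3
  · simp
  · simp

/-- Poincaré recurrence in both horizontal directions. -/
lemma ae_recurrence [IsFiniteMeasure μ] {A : Set Config} (hA : MeasurableSet A) :
    ∀ᵐ ω ∂μ, ∀ x : ℤ, ((-x, 0) : ℤ × ℤ) +ᵥ ω ∈ A → ∀ N : ℤ,
      (∃ y > N, ((-y, 0) : ℤ × ℤ) +ᵥ ω ∈ A) ∧ ∃ y < N, ((-y, 0) : ℤ × ℤ) +ᵥ ω ∈ A := by
  filter_upwards [ae_recurrence_direction hA 1, ae_recurrence_direction hA (-1)] with ω h1 h2 x hx N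
  constructor
  · obtain ⟨n, hn, h⟩ := h1 x hx (N - x + 1).toNat
    exact ⟨_, by omega, h⟩
  · obtain ⟨n, hn, h⟩ := h2 x hx (x - N + 1).toNat
    exact ⟨_, by omega, h⟩

lemma ae_primalInf_recurrent [IsFiniteMeasure μ] :
    ∀ᵐ ω ∂μ, ∀ x : ℤ, PrimalInf 0 x ω → ∀ N : ℤ,
      (∃ y > N, PrimalInf 0 y ω) ∧ ∃ y < N, PrimalInf 0 y ω := by
  filter_upwards [ae_recurrence (measurableSet_primalInf 0 0)] with ω h
  simpa [primalInf_vadd] using h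

lemma ae_dualInf_recurrent [IsFiniteMeasure μ] :
    ∀ᵐ ω ∂μ, ∀ x : ℤ, DualInf 0 x ω → ∀ N : ℤ,
      (∃ y > N, DualInf 0 y ω) ∧ ∃ y < N, DualInf 0 y ω := by
  filter_upwards [ae_recurrence (measurableSet_dualInf 0 0)] with ω h
  simpa [dualInf_vadd] using h

/-- A decreasing translation-covariant sequence of events is almost surely constant, because the
events all have the same probability. -/
lemma ae_forall_of_anti [IsFiniteMeasure μ] {E : ℤ → Set Config} (hE : ∀ j, MeasurableSet (E j))
    (hanti : ∀ i j, i ≤ j → E j ⊆ E i)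
    (hcov : ∀ j, E j = (fun ω : Config => ((0, -j) : ℤ × ℤ) +ᵥ ω) ⁻¹' E 0) :
    ∀ᵐ ω ∂μ, ω ∈ E 0 → ∀ j : ℕ, ω ∈ E j := by
  suffices h : ∀ᵐ ω ∂μ, ∀ j : ℕ, ω ∈ E 0 → ω ∈ E j from h.mono fun ω h h0 j => h j h0
  refine ae_all_iff.2 fun j => ?_
  have hμ : μ (E 0) ≤ μ (E j) := by
    rw [hcov j, VAddInvariantMeasure.measure_preimage_vadd _ (hE 0)]
  have := ae_eq_of_subset_of_measure_ge (hanti 0 j (Int.natCast_nonneg j)) hμ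
    (hE j).nullMeasurableSet (measure_ne_top μ _)
  exact this.symm.le

variable (μ) in
lemma ae_primal_halfPlane [IsFiniteMeasure μ] :
    ∀ᵐ ω ∂μ, (∃ v, InInfiniteCluster (halfPlane (primal ω) 0) v) →
      ∀ j : ℕ, ∃ v, InInfiniteCluster (halfPlane (primal ω) j) v := by
  refine ae_forall_of_anti (E := fun j => {ω | ∃ v, InInfiniteCluster (halfPlane (primal ω) j) v})
    (fun j => ?_) (fun i j hij ω ⟨v, hv⟩ => ⟨v, hv.mono (halfPlane_anti _ hij)⟩) fun j => ?_
  · simp only [Set.ofPred_exists]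
    exact MeasurableSet.iUnion fun v =>
      measurableSet_inInfiniteCluster (measurableSet_halfPlane_primal_adj j) v
  · ext ω
    simpa using (exists_inInfiniteCluster_shift (halfPlane_primal_vadd_adj (0, -j) ω 0)).symm

variable (μ) in
lemma ae_dual_halfPlane [IsFiniteMeasure μ] :
    ∀ᵐ ω ∂μ, (∃ v, InInfiniteCluster (halfPlane (dual ω) 0) v) →
      ∀ j : ℕ, ∃ v, InInfiniteCluster (halfPlane (dual ω) j) v := by
  refine ae_forall_of_anti (E := fun j => {ω | ∃ v, InInfiniteCluster (halfPlane (dual ω) j) v})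
    (fun j => ?_) (fun i j hij ω ⟨v, hv⟩ => ⟨v, hv.mono (halfPlane_anti _ hij)⟩) fun j => ?_
  · simp only [Set.ofPred_exists]
    exact MeasurableSet.iUnion fun v =>
      measurableSet_inInfiniteCluster (measurableSet_halfPlane_dual_adj j) v
  · ext ω
    simpa using (exists_inInfiniteCluster_shift (halfPlane_dual_vadd_adj (0, -j) ω 0)).symm

end Invariance

/-! ### Counting clusters along a row -/

/-- The vertex `(x, j)` is the first vertex of `{0, 1, …} × {j}` in its cluster of the fringed
half-plane of height `j`, and this cluster is infinite. -/
def IsFirst (G : SimpleGraph (ℤ × ℤ)) (j : ℤ) (x : ℕ) : Prop :=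
  InInfiniteCluster (fringe G j) (x, j) ∧ ∀ y : ℕ, y < x → ¬ (fringe G j).Reachable (x, j) (y, j)

/-- The vertex `(x, 0)` is in an infinite cluster of the fringed half-plane of height `0`, and in
the fringed half-plane of height `-k` this cluster is not connected to an infinite cluster of the
former that contains one of the vertices `(0, 0), …, (x - 1, 0)`. -/
def IsFirstMerged (G : SimpleGraph (ℤ × ℤ)) (k x : ℕ) : Prop :=
  InInfiniteCluster (fringe G 0) (x, 0) ∧ ∀ y : ℕ, y < x → InInfiniteCluster (fringe G 0) (y, 0) →
    ¬ (fringe G (-k)).Reachable (x, 0) (y, 0)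

/-- The cluster of `(x, 0)` in the fringed half-plane of height `0` is finite, but contains a vertex
of the row `y = 0` outside of `[0, n) × {0}`. -/
def ReachesOut (G : SimpleGraph (ℤ × ℤ)) (n x : ℕ) : Prop :=
  ¬ InInfiniteCluster (fringe G 0) (x, 0) ∧
    ∃ u : ℤ, (u < 0 ∨ (n : ℤ) ≤ u) ∧ (fringe G 0).Reachable (x, 0) (u, 0)

section Counting

open Finset

open scoped Classical in
/-- Each infinite cluster of the fringed half-plane of height `-k` that meets `[0, n) × {-k}` is
counted by its first vertex there. Follow it from this vertex. Either it contains an infinite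
cluster of the fringed half-plane of height `0` that meets `[0, n) × {0}`, and is then counted by the
first such vertex, or it leaves the box `[0, n) × [-k, 0]` through a side, or it leaves it through a
finite cluster that reaches over the end of the interval. -/
lemma card_isFirst_le {G : SimpleGraph (ℤ × ℤ)}
    (hG : ∀ u v, G.Adj u v → |u.1 - v.1| ≤ 1 ∧ |u.2 - v.2| ≤ 1) (k n : ℕ) :
    #{x ∈ range n | IsFirst G (-k) x} ≤
      #{x ∈ range n | IsFirstMerged G k x} + #{x ∈ range n | ReachesOut G n x} + 2 * (k + 1) := by
  set M := {x ∈ range n | IsFirstMerged G k x} with hM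
  set E := {x ∈ range n | ReachesOut G n x} with hE
  set side : Finset (ℤ × ℤ) := ({0, (n : ℤ) - 1} : Finset ℤ) ×ˢ Icc (-(k : ℤ)) 0 with hside
  have hcard : #(M.image (fun x : ℕ => ((x : ℤ), (0 : ℤ))) ∪
      E.image (fun x : ℕ => ((x : ℤ), (0 : ℤ))) ∪ side) ≤ #M + #E + 2 * (k + 1) := by
    refine (card_union_le _ _).trans (add_le_add ((card_union_le _ _).trans
      (add_le_add card_image_le card_image_le)) ?_)
    rw [hside, card_product]
    refine Nat.mul_le_mul card_le_two ?_
    rw [Int.card_Icc]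
    omega
  refine le_trans (card_le_card_of_forall_subsingleton
    (fun (x : ℕ) t => (fringe G (-k)).Reachable ((x : ℤ), -(k : ℤ)) t) (fun x hx => ?_)
    (fun t _ x hx y hy => ?_)) hcard
  · rw [mem_filter, mem_range] at hx
    obtain ⟨hxn, hxinf, -⟩ := hx
    have hle : fringe G 0 ≤ fringe G (-k) := fringe_anti G (by omega)
    by_cases hy : ∃ y : ℕ, y < n ∧ InInfiniteCluster (fringe G 0) ((y : ℤ), (0 : ℤ)) ∧
        (fringe G (-k)).Reachable ((x : ℤ), -(k : ℤ)) ((y : ℤ), (0 : ℤ))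
    · obtain ⟨hyn, hyinf, hxy⟩ := Nat.find_spec hy
      refine ⟨_, mem_union_left _ (mem_union_left _ (mem_image_of_mem _ (a := Nat.find hy) ?_)),
        hxy⟩
      rw [hM, mem_filter, mem_range]
      exact ⟨hyn, hyinf, fun z hz hzinf hyz =>
        Nat.find_min hy hz ⟨hz.trans hyn, hzinf, hxy.trans hyz⟩⟩
    · push Not at hy
      have hfin : ((Set.Ico (0 : ℤ) n) ×ˢ (Set.Icc (-(k : ℤ)) 0) ∪
          ⋃ y ∈ {y : ℕ | y < n ∧ ¬ InInfiniteCluster (fringe G 0) ((y : ℤ), (0 : ℤ))},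
            {w | (fringe G 0).Reachable ((y : ℤ), (0 : ℤ)) w}).Finite := by
        refine ((Set.finite_Ico _ _).prod (Set.finite_Icc _ _)).union
          (Set.Finite.biUnion ((Set.finite_lt_nat n).subset fun y hy => hy.1) fun y hy => ?_)
        exact Set.not_infinite.1 hy.2
      obtain ⟨u, hu, v, hv, hxu, huv⟩ := hxinf.exists_adj_exit hfin
        (Or.inl ⟨⟨by simp, by simpa using hxn⟩, by simp, by simp⟩)
      simp only [Set.mem_union, Set.mem_iUnion, not_or, not_exists] at hv
      obtain ⟨hv1, hv2⟩ := hv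
      by_cases hedge : (fringe G 0).Adj u v
      · -- An edge of the upper fringed half-plane leads out of the box only if its cluster is
        -- infinite.
        exfalso
        rcases hu with ⟨⟨hu0, hun⟩, -, hu2⟩ | hu
        · have h0 : u.2 = 0 := le_antisymm hu2 hedge.2.1
          have hueq : u = ((u.1.toNat : ℤ), (0 : ℤ)) := Prod.ext (by simp [hu0]) h0
          rw [hueq] at hxu hedge
          by_cases hinf : InInfiniteCluster (fringe G 0) ((u.1.toNat : ℤ), (0 : ℤ))
          · exact hy _ (by omega) hinf hxu
          · exact hv2 u.1.toNat ⟨by omega, hinf⟩ hedge.reachable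
        · simp only [Set.mem_iUnion] at hu
          obtain ⟨y, hyn, hyu⟩ := hu
          exact hv2 y hyn (SimpleGraph.Reachable.trans hyu hedge.reachable)
      · obtain ⟨hadj, hu2, hv2', -⟩ := huv
        have hnear := hG u v hadj
        rw [abs_le, abs_le] at hnear
        have hrow : u.2 ≤ 0 ∧ v.2 ≤ 0 := by
          by_contra hcon
          refine hedge ⟨hadj, ?_, ?_, ?_⟩ <;> omega
        have hv1' : ¬ (0 ≤ v.1 ∧ v.1 < n) := fun h => hv1 ⟨h, hv2', hrow.2⟩
        by_cases hu1 : 0 ≤ u.1 ∧ u.1 < n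
        · refine ⟨u, mem_union_right _ (mem_product.2 ⟨?_, mem_Icc.2 ⟨hu2, hrow.1⟩⟩), hxu⟩
          rw [mem_insert, mem_singleton]
          omega
        · rcases hu with ⟨hu, -⟩ | hu
          · exact absurd hu hu1
          · simp only [Set.mem_iUnion] at hu
            obtain ⟨y, ⟨hyn, hyfin⟩, hyu⟩ := hu
            have hu0 : 0 ≤ u.2 := reachable_induction (P := fun u => 0 ≤ u.2) le_rfl
              (fun _ _ _ (h : (fringe G 0).Adj _ _) _ => h.2.2.1) hyu
            have hueq : u = (u.1, 0) := Prod.ext rfl (le_antisymm hrow.1 hu0)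
            refine ⟨_, mem_union_left _ (mem_union_right _ (mem_image_of_mem _ (a := y) ?_)),
              hxu.trans (hyu.mono hle).symm⟩
            rw [hE, mem_filter, mem_range]
            exact ⟨hyn, hyfin, u.1, by omega, hueq ▸ hyu⟩
  · rw [Set.mem_ofPred_eq, mem_filter] at hx hy
    have hxy := hx.2.trans hy.2.symm
    rcases lt_trichotomy x y with h | h | h
    · exact absurd hxy.symm (hy.1.2.2 x h)
    · exact h
    · exact absurd hxy (hx.1.2.2 y h)


open scoped Classical in
lemma integrable_card {Ω ι : Type*} [MeasurableSpace Ω] {μ : Measure Ω} [IsFiniteMeasure μ]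
    (s : Finset ι) {A : ι → Ω → Prop} (hA : ∀ i, MeasurableSet {ω | A i ω}) :
    Integrable (fun ω => (#{i ∈ s | A i ω} : ℝ)) μ ∧
      ∫ ω, (#{i ∈ s | A i ω} : ℝ) ∂μ = ∑ i ∈ s, μ.real {ω | A i ω} := by
  have hint : ∀ i ∈ s, Integrable ({ω | A i ω}.indicator (1 : Ω → ℝ)) μ :=
    fun i _ => (integrable_const (1 : ℝ)).indicator (hA i)
  have heq : (fun ω => (#{i ∈ s | A i ω} : ℝ)) =
      fun ω => ∑ i ∈ s, {ω | A i ω}.indicator (1 : Ω → ℝ) ω := by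
    funext ω
    simp [Set.indicator_apply]
  rw [heq, integral_finsetSum s hint]
  exact ⟨integrable_finsetSum s hint, sum_congr rfl fun i _ => integral_indicator_one (hA i)⟩

lemma primal_adj_near {ω : Config} (u v : ℤ × ℤ) (h : (primal ω).Adj u v) :
    |u.1 - v.1| ≤ 1 ∧ |u.2 - v.2| ≤ 1 := by
  rw [abs_le, abs_le]
  rcases primal_adj.1 h with ⟨x, y, -, ⟨rfl, rfl⟩ | ⟨rfl, rfl⟩⟩ |
    ⟨x, y, -, ⟨rfl, rfl⟩ | ⟨rfl, rfl⟩⟩ <;> dsimp only <;> omega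

lemma measurableSet_isFirst (j : ℤ) (x : ℕ) :
    MeasurableSet {ω : Config | IsFirst (primal ω) j x} := by
  simp only [IsFirst, Set.ofPred_and, Set.ofPred_forall]
  exact (measurableSet_primalInf j x).inter (.iInter fun y => .iInter fun _ =>
    (measurableSet_fringe_reachable j _ _).compl)

lemma measurableSet_isFirstMerged (k x : ℕ) :
    MeasurableSet {ω : Config | IsFirstMerged (primal ω) k x} := by
  simp only [IsFirstMerged, imp_iff_not_or (b := ¬ _), Set.ofPred_and, Set.ofPred_forall,
    Set.ofPred_or]
  exact (measurableSet_primalInf 0 x).inter (.iInter fun y => .iInter fun _ =>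
    (measurableSet_primalInf 0 y).compl.union (measurableSet_fringe_reachable (-k) _ _).compl)

lemma measurableSet_reachesOut (n x : ℕ) :
    MeasurableSet {ω : Config | ReachesOut (primal ω) n x} := by
  simp only [ReachesOut, Set.ofPred_and, Set.ofPred_exists]
  exact (measurableSet_primalInf 0 x).compl.inter (.iUnion fun u =>
    (MeasurableSet.const _).inter (measurableSet_fringe_reachable 0 _ _))

lemma sum_isFirst_le (μ : Measure Config) [IsProbabilityMeasure μ] (k n : ℕ) :
    ∑ x ∈ range n, μ.real {ω | IsFirst (primal ω) (-k) x} ≤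
      ∑ x ∈ range n, μ.real {ω | IsFirstMerged (primal ω) k x} +
      ∑ x ∈ range n, μ.real {ω | ReachesOut (primal ω) n x} + 2 * (k + 1) := by
  classical
  obtain ⟨hI, hI'⟩ := integrable_card (μ := μ) (range n) (measurableSet_isFirst (-k))
  obtain ⟨hM, hM'⟩ := integrable_card (μ := μ) (range n) (measurableSet_isFirstMerged k)
  obtain ⟨hR, hR'⟩ := integrable_card (μ := μ) (range n) (measurableSet_reachesOut n)
  have hc : ∫ _ : Config, (2 * ((k : ℝ) + 1)) ∂μ = 2 * (k + 1) := by simp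
  have hMR : Integrable (fun ω => (#{x ∈ range n | IsFirstMerged (primal ω) k x} : ℝ) +
      #{x ∈ range n | ReachesOut (primal ω) n x}) μ := hM.add hR
  rw [← hI', ← hM', ← hR', ← hc, ← integral_add hM hR, ← integral_add hMR (integrable_const _)]
  refine integral_mono hI (hMR.add (integrable_const _)) fun ω => ?_
  have h := card_isFirst_le (G := primal ω) primal_adj_near k n
  dsimp only
  exact_mod_cast h

end Counting

/-! ### Clusters of a fringed half-plane do not merge below it -/

/-- The vertex `(x, 0)` is the leftmost vertex on the row `y = 0` of an infinite cluster of the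
fringed half-plane of height `0`, the vertex `(x - l, 0)` belongs to an infinite cluster as well, and
the two are connected in the fringed half-plane of height `-k`. -/
def LeftmostMerges (G : SimpleGraph (ℤ × ℤ)) (k l : ℕ) (x : ℤ) : Prop :=
  InInfiniteCluster (fringe G 0) (x, 0) ∧ InInfiniteCluster (fringe G 0) (x - l, 0) ∧
    (∀ y < x, ¬ (fringe G 0).Reachable (x, 0) (y, 0)) ∧
    (fringe G (-k)).Reachable (x, 0) (x - l, 0)

lemma measurableSet_leftmostMerges (k l : ℕ) (x : ℤ) :
    MeasurableSet {ω : Config | LeftmostMerges (primal ω) k l x} := by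
  simp only [LeftmostMerges, Set.ofPred_and, Set.ofPred_forall]
  exact (measurableSet_primalInf 0 x).inter ((measurableSet_primalInf 0 _).inter
    ((MeasurableSet.iInter fun y => .iInter fun _ =>
      (measurableSet_fringe_reachable 0 _ _).compl).inter (measurableSet_fringe_reachable (-k) _ _)))

lemma isFirstMerged_isFirst {G : SimpleGraph (ℤ × ℤ)} {k x : ℕ} (h : IsFirstMerged G k x) :
    IsFirst G 0 x :=
  ⟨h.1, fun y hy hxy => h.2 y hy (h.1.of_reachable hxy) (hxy.mono (fringe_anti G (by omega)))⟩

lemma leftmostMerges_isFirst {G : SimpleGraph (ℤ × ℤ)} {k l x : ℕ} (h : LeftmostMerges G k l x) :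
    IsFirst G 0 x :=
  ⟨h.1, fun y hy => h.2.2.1 y (by exact_mod_cast hy)⟩

lemma leftmostMerges_not_isFirstMerged {G : SimpleGraph (ℤ × ℤ)} {k l x : ℕ} (hl : 0 < l)
    (hlx : l ≤ x) (h : LeftmostMerges G k l x) : ¬ IsFirstMerged G k x := by
  intro hM
  have hcast : ((x - l : ℕ) : ℤ) = (x : ℤ) - l := by omega
  refine hM.2 (x - l) (by omega) ?_ ?_
  · rw [hcast]
    exact h.2.1
  · rw [hcast]
    exact h.2.2.2

section Density

variable {μ : Measure Config} [VAddInvariantMeasure (ℤ × ℤ) Config μ]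

lemma leftmostMerges_vadd (k l : ℕ) (x : ℤ) (ω : Config) :
    LeftmostMerges (primal (((-x, 0) : ℤ × ℤ) +ᵥ ω)) k l 0 ↔ LeftmostMerges (primal ω) k l x := by
  simp only [LeftmostMerges, fringe_reachable_vadd,
    inInfiniteCluster_shift (fringe_vadd_adj (-x, 0) ω 0), Prod.mk_sub_mk, sub_neg_eq_add, zero_add,
    sub_zero]
  have hl : 0 - (l : ℤ) + x = x - l := by ring
  refine and_congr Iff.rfl (and_congr ?_ (and_congr ⟨fun h y hy => ?_, fun h y hy => ?_⟩ ?_))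
  · rw [hl]
  · simpa using h (y - x) (by omega)
  · exact h (y + x) (by omega)
  · rw [hl]

lemma measureReal_leftmostMerges (k l : ℕ) (x : ℤ) :
    μ.real {ω | LeftmostMerges (primal ω) k l x} =
      μ.real {ω | LeftmostMerges (primal ω) k l 0} := by
  rw [← (measurePreserving_translation μ (-x, 0)).measureReal_preimage
    (measurableSet_leftmostMerges k l 0).nullMeasurableSet]
  congr 1
  ext ω
  exact (leftmostMerges_vadd k l x ω).symm

lemma measureReal_isFirst (j : ℤ) (x : ℕ) :
    μ.real {ω | IsFirst (primal ω) j x} = μ.real {ω | IsFirst (primal ω) 0 x} := by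
  rw [← (measurePreserving_translation μ (0, -j)).measureReal_preimage
    (measurableSet_isFirst 0 x).nullMeasurableSet]
  congr 1
  ext ω
  simp only [Set.mem_preimage, Set.mem_ofPred_eq, IsFirst, fringe_reachable_vadd,
    inInfiniteCluster_shift (fringe_vadd_adj (0, -j) ω 0), Prod.mk_sub_mk, sub_neg_eq_add, zero_add,
    sub_zero]

/-- The cluster of the origin in the fringed half-plane is finite and contains a vertex of its bottom
row at distance more than `r`. -/
def FiniteWide (G : SimpleGraph (ℤ × ℤ)) (r : ℕ) : Prop :=
  ¬ InInfiniteCluster (fringe G 0) (0, 0) ∧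
    ∃ u : ℤ, (r : ℤ) < |u| ∧ (fringe G 0).Reachable (0, 0) (u, 0)

lemma measurableSet_finiteWide (r : ℕ) : MeasurableSet {ω : Config | FiniteWide (primal ω) r} := by
  simp only [FiniteWide, Set.ofPred_and, Set.ofPred_exists]
  exact (measurableSet_primalInf 0 0).compl.inter (.iUnion fun u =>
    (MeasurableSet.const _).inter (measurableSet_fringe_reachable 0 _ _))

lemma tendsto_finiteWide (μ : Measure Config) [IsFiniteMeasure μ] :
    Tendsto (fun r : ℕ => μ.real {ω | FiniteWide (primal ω) r}) atTop (nhds 0) := by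
  have hanti : Antitone fun r : ℕ => {ω : Config | FiniteWide (primal ω) r} :=
    fun r s hrs ω ⟨h, u, hu, hu'⟩ => ⟨h, u, lt_of_le_of_lt (by exact_mod_cast hrs) hu, hu'⟩
  have h := tendsto_measure_iInter_atTop (μ := μ)
    (fun r => (measurableSet_finiteWide r).nullMeasurableSet) hanti ⟨0, measure_ne_top _ _⟩
  have hempty : ⋂ r : ℕ, {ω : Config | FiniteWide (primal ω) r} = ∅ := by
    refine Set.eq_empty_of_forall_notMem fun ω hω => ?_
    rw [Set.mem_iInter] at hω
    have hfin := Set.not_infinite.1 (hω 0).1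
    obtain ⟨b, hb⟩ := (hfin.image fun w : ℤ × ℤ => w.1.natAbs).bddAbove
    obtain ⟨-, u, hu, hu'⟩ := hω b
    have : u.natAbs ≤ b := hb ⟨(u, 0), hu', rfl⟩
    rw [Int.abs_eq_natAbs] at hu
    omega
  rw [hempty, measure_empty] at h
  exact (ENNReal.tendsto_toReal ENNReal.zero_ne_top).comp h

lemma measureReal_reachesOut_le [IsFiniteMeasure μ] {n x : ℕ} (hx : x < n) :
    μ.real {ω | ReachesOut (primal ω) n x} ≤
      μ.real {ω | FiniteWide (primal ω) x} + μ.real {ω | FiniteWide (primal ω) (n - 1 - x)} := by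
  have hT := measurePreserving_translation μ (-(x : ℤ), 0)
  rw [← hT.measureReal_preimage (measurableSet_finiteWide x).nullMeasurableSet,
    ← hT.measureReal_preimage (measurableSet_finiteWide (n - 1 - x)).nullMeasurableSet]
  refine (measureReal_mono ?_).trans (measureReal_union_le _ _)
  rintro ω ⟨hfin, u, hu, hxu⟩
  simp only [Set.mem_union, Set.mem_preimage, Set.mem_ofPred_eq, FiniteWide, fringe_reachable_vadd,
    inInfiniteCluster_shift (fringe_vadd_adj (-(x : ℤ), 0) ω 0), Prod.mk_sub_mk, sub_neg_eq_add,
    zero_add, sub_zero]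
  rcases hu with hu | hu
  · refine Or.inl ⟨hfin, u - x, ?_, by simpa using hxu⟩
    rw [lt_abs]
    omega
  · refine Or.inr ⟨hfin, u - x, ?_, by simpa using hxu⟩
    rw [lt_abs]
    omega

open Finset in
/-- The expected number of infinite clusters of a fringed half-plane that meet an interval of its
bottom row does not depend on its height. Since every mergence of two clusters below the row
reduces this number, mergences have density zero. -/
lemma measureReal_leftmostMerges_eq_zero [IsProbabilityMeasure μ] {l : ℕ} (hl : 0 < l) (k : ℕ) :
    μ.real {ω | LeftmostMerges (primal ω) k l 0} = 0 := by
  set g := μ.real {ω | LeftmostMerges (primal ω) k l 0} with hg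
  set w : ℕ → ℝ := fun r => μ.real {ω | FiniteWide (primal ω) r} with hw
  have hstep : ∀ x : ℕ, μ.real {ω | IsFirstMerged (primal ω) k x} + (if l ≤ x then g else 0) ≤
      μ.real {ω | IsFirst (primal ω) 0 x} := by
    intro x
    split_ifs with hlx
    · have hdisj : Disjoint {ω : Config | IsFirstMerged (primal ω) k x}
          {ω : Config | LeftmostMerges (primal ω) k l x} := Set.disjoint_left.2
        fun ω h1 h2 => leftmostMerges_not_isFirstMerged hl hlx h2 h1
      rw [hg, ← measureReal_leftmostMerges k l x,
        ← measureReal_union hdisj (measurableSet_leftmostMerges k l x)]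
      exact measureReal_mono (Set.union_subset (fun ω h => isFirstMerged_isFirst h)
        fun ω h => leftmostMerges_isFirst h)
    · rw [add_zero]
      exact measureReal_mono fun ω h => isFirstMerged_isFirst h
  have hmain : ∀ n : ℕ, ((n : ℝ) - l) * g ≤ 2 * ∑ x ∈ range n, w x + 2 * (k + 1) := by
    intro n
    have h1 := sum_isFirst_le μ k n
    simp only [measureReal_isFirst (-(k : ℤ))] at h1
    have h2 := sum_le_sum fun x (_ : x ∈ range n) => hstep x
    rw [sum_add_distrib] at h2
    have h3 : ((n : ℝ) - l) * g ≤ ∑ x ∈ range n, (if l ≤ x then g else 0) := by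
      rw [← sum_filter, sum_const, nsmul_eq_mul]
      refine mul_le_mul_of_nonneg_right ?_ measureReal_nonneg
      have : range n \ range l ⊆ {x ∈ range n | l ≤ x} := fun x hx => by
        simpa using hx
      have h4 := card_le_card this
      have h5 := le_card_sdiff (range l) (range n)
      simp only [card_range] at h5
      have h6 : n ≤ #{x ∈ range n | l ≤ x} + l := by omega
      have h7 : (n : ℝ) ≤ #{x ∈ range n | l ≤ x} + l := by exact_mod_cast h6
      linarith
    have h8 : ∑ x ∈ range n, μ.real {ω | ReachesOut (primal ω) n x} ≤ 2 * ∑ x ∈ range n, w x := by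
      refine (sum_le_sum fun x hx => measureReal_reachesOut_le (mem_range.1 hx)).trans ?_
      rw [sum_add_distrib, sum_range_reflect w n, two_mul]
    linarith
  have hlim : Tendsto (fun n : ℕ => 2 * ((n : ℝ)⁻¹ * ∑ x ∈ range n, w x) +
      (2 * (k + 1) + l * g) / (n : ℝ)) atTop (nhds (2 * 0 + 0)) :=
    ((tendsto_finiteWide μ).cesaro.const_mul 2).add (tendsto_const_div_atTop_nhds_zero_nat _)
  refine le_antisymm (ge_of_tendsto (by simpa using hlim) ?_) measureReal_nonneg
  filter_upwards [eventually_gt_atTop 0] with n hn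
  have hn' : (0 : ℝ) < n := by exact_mod_cast hn
  have := hmain n
  have heq : 2 * ((n : ℝ)⁻¹ * ∑ x ∈ range n, w x) + (2 * (k + 1) + l * g) / (n : ℝ) =
      (2 * ∑ x ∈ range n, w x + 2 * (k + 1) + l * g) / n := by
    field_simp
    ring
  rw [heq, le_div_iff₀ hn']
  linarith

/-- Almost surely, two infinite clusters of the fringed half-plane that both reach its bottom row
and have leftmost vertices there are not connected in the whole plane. -/
lemma ae_not_reachable_of_leftmost [IsProbabilityMeasure μ] :
    ∀ᵐ ω ∂μ, ∀ x y : ℤ, y < x → PrimalInf 0 x ω → PrimalInf 0 y ω →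
      (∀ z < x, ¬ (fringe (primal ω) 0).Reachable (x, 0) (z, 0)) →
      ¬ (primal ω).Reachable (x, 0) (y, 0) := by
  have h : ∀ᵐ ω ∂μ, ∀ (x : ℤ) (k l : ℕ), 0 < l → ¬ LeftmostMerges (primal ω) k l x := by
    refine ae_all_iff.2 fun x => ae_all_iff.2 fun k => ae_all_iff.2 fun l => ?_
    by_cases hl : 0 < l
    · have h0 : μ.real {ω | LeftmostMerges (primal ω) k l x} = 0 := by
        rw [measureReal_leftmostMerges, measureReal_leftmostMerges_eq_zero hl]
      rw [measureReal_eq_zero_iff] at h0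
      filter_upwards [measure_eq_zero_iff_ae_notMem.1 h0] with ω hω _
      exact hω
    · exact .of_forall fun ω h => absurd h hl
  filter_upwards [h] with ω hω x y hyx hx hy hleft hxy
  obtain ⟨k, hk⟩ := exists_fringe_reachable hxy
  have hcast : y = x - ((x - y).toNat : ℤ) := by omega
  refine hω x k (x - y).toNat (by omega) ⟨hx, ?_, hleft, ?_⟩
  · rw [← hcast]
    exact hy
  · rw [← hcast]
    exact hk

end Density

/-! ### Coexistence on the boundary of a half-plane -/

section Boundary

variable {ω : Config}

lemma exists_leftmost {x b : ℤ} (hb : DualInf 0 b ω) (hbx : b < x) :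
    ∃ l, (fringe (primal ω) 0).Reachable (x, 0) (l, 0) ∧
      ∀ z < l, ¬ (fringe (primal ω) 0).Reachable (l, 0) (z, 0) := by
  classical
  obtain ⟨l, hl, hmin⟩ := Int.exists_least_of_bdd
    (P := fun l => (fringe (primal ω) 0).Reachable (x, 0) (l, 0))
    ⟨b, fun z hz => by
      by_contra! hzb
      exact not_inInfiniteCluster_dual_of_reachable hzb.le hbx hz.symm hb⟩ ⟨x, .rfl⟩
  exact ⟨l, hl, fun z hz hlz => (hmin z (hl.trans hlz)).not_gt hz⟩

/-- If clusters with leftmost vertices do not merge, and infinite dual clusters touch the bottom row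
arbitrarily far to the left, then clusters do not merge. -/
lemma not_reachable_of_not_fringe_reachable
    (hω : ∀ x y : ℤ, y < x → PrimalInf 0 x ω → PrimalInf 0 y ω →
      (∀ z < x, ¬ (fringe (primal ω) 0).Reachable (x, 0) (z, 0)) →
      ¬ (primal ω).Reachable (x, 0) (y, 0))
    (hD : ∀ N : ℤ, ∃ b < N, DualInf 0 b ω) {x y : ℤ} (hx : PrimalInf 0 x ω)
    (hy : PrimalInf 0 y ω) (hxy : ¬ (fringe (primal ω) 0).Reachable (x, 0) (y, 0)) :
    ¬ (primal ω).Reachable (x, 0) (y, 0) := by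
  obtain ⟨b, hbx, hb⟩ := hD x
  obtain ⟨c, hcy, hc⟩ := hD y
  obtain ⟨l, hl, hlmin⟩ := exists_leftmost hb hbx
  obtain ⟨m, hm, hmmin⟩ := exists_leftmost hc hcy
  intro h
  have hlm : (primal ω).Reachable (l, 0) (m, 0) :=
    ((hl.mono (fringe_le _ _)).symm.trans h).trans (hm.mono (fringe_le _ _))
  have hli : PrimalInf 0 l ω := InInfiniteCluster.of_reachable hl hx
  have hmi : PrimalInf 0 m ω := InInfiniteCluster.of_reachable hm hy
  rcases lt_trichotomy l m with hlt | rfl | hlt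
  · exact hω m l hlt hmi hli hmmin hlm.symm
  · exact hxy (hl.trans hm.symm)
  · exact hω l m hlt hli hmi hlmin hlm

/-- Vertices of infinite primal clusters that are separated by infinite dual clusters along the
bottom row. -/
lemma exists_separated_sequence (hP : ∀ N : ℤ, ∃ x > N, PrimalInf 0 x ω)
    (hD : ∀ N : ℤ, ∃ b > N, DualInf 0 b ω) :
    ∃ f : ℕ → ℤ, (∀ n, PrimalInf 0 (f n) ω) ∧
      ∀ m n, m < n → ¬ (fringe (primal ω) 0).Reachable (f m, 0) (f n, 0) := by
  have hnext : ∀ x : ℤ, ∃ y, PrimalInf 0 y ω ∧ ∃ b, x ≤ b ∧ b < y ∧ DualInf 0 b ω := by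
    intro x
    obtain ⟨b, hxb, hb⟩ := hD x
    obtain ⟨y, hby, hy⟩ := hP b
    exact ⟨y, hy, b, hxb.le, hby, hb⟩
  choose next hnextP hnextD using hnext
  have hsep : ∀ m n, m < n → ∃ b, next^[m + 1] 0 ≤ b ∧ b < next^[n + 1] 0 ∧ DualInf 0 b ω := by
    intro m n hmn
    induction n, hmn using Nat.le_induction with
    | base =>
      rw [Function.iterate_succ_apply' next (m + 1)]
      exact hnextD _
    | succ n _ ih =>
      obtain ⟨b, hb1, hb2, hb⟩ := ih
      obtain ⟨c, hc1, hc2, -⟩ := hnextD (next^[n + 1] 0)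
      rw [Function.iterate_succ_apply' next (n + 1)]
      exact ⟨b, hb1, by omega, hb⟩
  refine ⟨fun n => next^[n + 1] 0, fun n => ?_, fun m n hmn h => ?_⟩
  · dsimp only
    rw [Function.iterate_succ_apply']
    exact hnextP _
  · obtain ⟨b, hb1, hb2, hb⟩ := hsep m n hmn
    exact not_inInfiniteCluster_dual_of_reachable hb1 hb2 h hb

end Boundary

/-- Infinite primal and dual clusters both touch the boundary of the half-plane of height `j`. -/
def BoundaryCoexistence (j : ℤ) (ω : Config) : Prop :=
  (∃ x, PrimalInf j x ω) ∧ ∃ b, DualInf j b ω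

section Invariance

variable {μ : Measure Config} [VAddInvariantMeasure (ℤ × ℤ) Config μ]

/-- Coexistence on the boundary produces infinitely many clusters, not connected to each other even
in the whole plane. -/
lemma ae_boundaryCoexistence_sequence [IsProbabilityMeasure μ] :
    ∀ᵐ ω ∂μ, BoundaryCoexistence 0 ω → ∃ f : ℕ → ℤ, (∀ n, PrimalInf 0 (f n) ω) ∧
      ∀ m n, m < n → ¬ (primal ω).Reachable (f m, 0) (f n, 0) := by
  filter_upwards [ae_primalInf_recurrent (μ := μ), ae_dualInf_recurrent (μ := μ),
    ae_not_reachable_of_leftmost (μ := μ)] with ω hP hD hω ⟨⟨x, hx⟩, ⟨b, hb⟩⟩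
  obtain ⟨f, hf, hne⟩ := exists_separated_sequence (fun N => (hP x hx N).1) (fun N => (hD b hb N).1)
  exact ⟨f, hf, fun m n hmn => not_reachable_of_not_fringe_reachable hω
    (fun N => (hD b hb N).2) (hf m) (hf n) (hne m n hmn)⟩

lemma ae_forall_not_boundaryCoexistence (h : ∀ᵐ ω ∂μ, ¬ BoundaryCoexistence 0 ω) :
    ∀ᵐ ω ∂μ, ∀ j : ℤ, ¬ BoundaryCoexistence j ω := by
  refine ae_all_iff.2 fun j => (ae_translate h (0, -j)).mono fun ω hω => ?_
  simpa [BoundaryCoexistence, primalInf_vadd, dualInf_vadd] using hω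

end Invariance

/-! ### Finitely many infinite clusters -/

/-- If every half-plane has infinite clusters of both types, but there is no coexistence on any
boundary, then the boundary of some arbitrarily high half-plane is touched by an infinite dual
cluster, hence not by an infinite primal cluster. So the infinite primal clusters above it are
clusters of the whole plane, and there are infinitely many of them. -/
lemma infiniteClusters_primal_infinite {ω : Config}
    (hP : ∀ j : ℕ, ∃ v, InInfiniteCluster (halfPlane (primal ω) j) v)
    (hD : ∀ j : ℕ, ∃ v, InInfiniteCluster (halfPlane (dual ω) j) v)
    (hno : ∀ j : ℤ, ¬ BoundaryCoexistence j ω) : (infiniteClusters (primal ω)).Infinite := by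
  have key : ∀ J : ℕ, ∃ v, InInfiniteCluster (primal ω) v ∧
      ∀ w, (primal ω).Reachable v w → J < w.2 := by
    intro J
    obtain ⟨v, hv⟩ := hD J
    obtain ⟨⟨b, r⟩, hJr, hw⟩ := exists_lowest hv
    have hJr' : (J : ℤ) ≤ r := hJr
    obtain ⟨z, hz⟩ := hP (r + 1).toNat
    rw [Int.toNat_of_nonneg (by omega)] at hz
    -- An edge leading down from the cluster of `z` would connect the boundary to infinity.
    have hcl : ∀ w, (primal ω).Reachable z w → (halfPlane (primal ω) (r + 1)).Reachable z w := by
      intro w hzw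
      refine reachable_induction (P := fun w => (halfPlane (primal ω) (r + 1)).Reachable z w) .rfl
        (fun x y _ hxy hzx => hzx.trans ?_) hzw
      have hxinf := hz.of_reachable hzx
      have hx := le_of_inInfiniteCluster_halfPlane hxinf
      by_cases hy : r + 1 ≤ y.2
      · exact SimpleGraph.Adj.reachable ⟨hxy, hx, hy⟩
      · exfalso
        have hnear := abs_le.1 (primal_adj_near _ _ hxy).2
        have hyr : y = (y.1, r) := Prod.ext rfl (by omega)
        have hadj : (fringe (primal ω) r).Adj x (y.1, r) := by
          rw [← hyr]
          exact ⟨hxy, by omega, by omega, Or.inl (by omega)⟩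
        exact hno r ⟨⟨y.1, (hxinf.mono (halfPlane_le_fringe _ _)).of_reachable hadj.reachable⟩,
          b, hw⟩
    refine ⟨z, hz.mono (fun _ _ (h : (halfPlane (primal ω) (r + 1)).Adj _ _) => h.1),
      fun w hw => ?_⟩
    have := le_of_inInfiniteCluster_halfPlane (hz.of_reachable (hcl w hw))
    omega
  intro hfin
  obtain ⟨R, hR, hrep⟩ := exists_finite_representatives hfin
  obtain ⟨J, hJ⟩ := (hR.image fun v : ℤ × ℤ => v.2.toNat).bddAbove
  obtain ⟨v, hv, hvJ⟩ := key J
  obtain ⟨r, hrR, hvr⟩ := hrep v hv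
  have h1 := hvJ r hvr
  have h2 : r.2.toNat ≤ J := hJ ⟨r, hrR, rfl⟩
  omega

/-! ### Insertion tolerance -/

/-- The configuration obtained by opening all edges of a finite set. -/
def openEdges (F : Finset Edge) (ω : Config) : Config := fun e => if e ∈ F then true else ω e

lemma openEdges_of_notMem {F : Finset Edge} {e : Edge} (h : e ∉ F) (ω : Config) :
    openEdges F ω e = ω e := if_neg h

lemma openEdges_of_mem {F : Finset Edge} {e : Edge} (h : e ∈ F) (ω : Config) :
    openEdges F ω e = true := if_pos h

lemma measurable_openEdges (F : Finset Edge) : Measurable (openEdges F) := by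
  refine measurable_pi_lambda _ fun e => ?_
  by_cases h : e ∈ F
  · simp only [openEdges_of_mem h, measurable_const]
  · simp only [openEdges_of_notMem h]
    exact measurable_pi_apply e

lemma primal_le_openEdges (F : Finset Edge) (ω : Config) : primal ω ≤ primal (openEdges F ω) := by
  refine SimpleGraph.fromEdgeSet_mono ?_
  rintro _ ⟨e, he, rfl⟩
  refine ⟨e, ?_, rfl⟩
  by_cases h : e ∈ F
  · exact openEdges_of_mem h ω
  · rw [openEdges_of_notMem h, he]

lemma InsertionTolerant.ae_openEdges {μ : Measure Config} (hμ : InsertionTolerant μ)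
    (F : Finset Edge) {p : Config → Prop} (hp : MeasurableSet {ω | p ω}) (h : ∀ᵐ ω ∂μ, p ω) :
    ∀ᵐ ω ∂μ, p (openEdges F ω) := by
  induction F using Finset.induction_on with
  | empty =>
    have hid : ∀ ω, openEdges ∅ ω = ω := fun ω =>
      funext fun e => openEdges_of_notMem (Finset.notMem_empty e) ω
    simpa only [hid] using h
  | insert e F _ ih =>
    have heq : ∀ ω, openEdges (insert e F) ω = openEdges F (Function.update ω e true) := by
      intro ω
      funext e'
      by_cases h1 : e' ∈ F
      · rw [openEdges_of_mem h1, openEdges_of_mem (Finset.mem_insert_of_mem h1)]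
      · by_cases h2 : e' = e
        · subst h2
          rw [openEdges_of_mem (Finset.mem_insert_self _ _), openEdges_of_notMem h1,
            Function.update_self]
        · rw [openEdges_of_notMem h1, openEdges_of_notMem (by simp [h1, h2]),
            Function.update_of_ne h2]
    have hmeas : MeasurableSet {ω | ¬ p (openEdges (insert e F) ω)} :=
      (measurable_openEdges _ hp).compl
    rw [ae_iff]
    by_contra hpos
    have hlt := hμ e _ hmeas (pos_iff_ne_zero.2 hpos)
    refine hlt.ne' (measure_mono_null ?_ (ae_iff.1 ih))
    rintro _ ⟨ω, hω, rfl⟩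
    rw [Set.mem_ofPred_eq, ← heq]
    exact hω

section RowEdges

variable {ω ω' : Config}

lemma fringe_le_of_eq (h : ∀ e : Edge, e.1.2 ≠ 0 ∨ e.2 = true → ω e = ω' e) :
    fringe (primal ω) 0 ≤ fringe (primal ω') 0 := by
  rintro u v ⟨hadj, hu, hv, hpos⟩
  refine ⟨primal_adj.2 ?_, hu, hv, hpos⟩
  rcases primal_adj.1 hadj with ⟨x, y, he, huv⟩ | ⟨x, y, he, huv⟩
  · refine Or.inl ⟨x, y, ?_, huv⟩
    rw [← h _ (Or.inl ?_), he]
    rcases huv with ⟨rfl, rfl⟩ | ⟨rfl, rfl⟩ <;> dsimp only at * <;> omega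
  · exact Or.inr ⟨x, y, (h _ (Or.inr rfl)).symm.trans he, huv⟩

lemma halfPlane_dual_le_of_eq (h : ∀ e : Edge, e.1.2 ≠ 0 ∨ e.2 = true → ω e = ω' e) :
    halfPlane (dual ω) 0 ≤ halfPlane (dual ω') 0 := by
  rintro u v ⟨hadj, hu, hv⟩
  refine ⟨dual_adj.2 ?_, hu, hv⟩
  rcases dual_adj.1 hadj with ⟨x, y, he, huv⟩ | ⟨x, y, he, huv⟩
  · refine Or.inl ⟨x, y, ?_, huv⟩
    rw [← h _ (Or.inl ?_), he]
    rcases huv with ⟨rfl, rfl⟩ | ⟨rfl, rfl⟩ <;> dsimp only at * <;> omega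
  · exact Or.inr ⟨x, y, (h _ (Or.inr rfl)).symm.trans he, huv⟩

end RowEdges

lemma measurableSet_exists_primalInf : MeasurableSet {ω | ∃ x, PrimalInf 0 x ω} := by
  simp only [Set.ofPred_exists]
  exact .iUnion fun x => measurableSet_primalInf 0 x

lemma measurableSet_exists_dualInf : MeasurableSet {ω | ∃ b, DualInf 0 b ω} := by
  simp only [Set.ofPred_exists]
  exact .iUnion fun b => measurableSet_dualInf 0 b

section Insertion

variable {μ : Measure Config} [IsProbabilityMeasure μ] [VAddInvariantMeasure (ℤ × ℤ) Config μ]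

/-- Opening edges of the row `y = 0` merges two clusters of the fringed half-plane without changing
them, which is impossible if there is coexistence on the boundary. -/
lemma ae_not_boundaryCoexistence_of_insertionTolerant (hμ : InsertionTolerant μ) :
    ∀ᵐ ω ∂μ, ¬ BoundaryCoexistence 0 ω := by
  have hnull : ∀ (x y : ℤ), ∀ᵐ ω ∂μ, ¬ (PrimalInf 0 x ω ∧ PrimalInf 0 y ω ∧
      (∃ b, DualInf 0 b ω) ∧ ¬ (fringe (primal ω) 0).Reachable (x, 0) (y, 0) ∧
      (primal ω).Reachable (x, 0) (y, 0)) := by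
    intro x y
    filter_upwards [ae_dualInf_recurrent (μ := μ), ae_not_reachable_of_leftmost (μ := μ)]
      with ω hD hω ⟨hx, hy, ⟨b, hb⟩, hne, hxy⟩
    exact not_reachable_of_not_fringe_reachable hω (fun N => (hD b hb N).2) hx hy hne hxy
  have hmeas : ∀ x y : ℤ, MeasurableSet {ω | ¬ (PrimalInf 0 x ω ∧ PrimalInf 0 y ω ∧
      (∃ b, DualInf 0 b ω) ∧ ¬ (fringe (primal ω) 0).Reachable (x, 0) (y, 0) ∧
      (primal ω).Reachable (x, 0) (y, 0))} := by
    intro x y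
    exact MeasurableSet.compl ((measurableSet_primalInf 0 x).inter
      ((measurableSet_primalInf 0 y).inter (measurableSet_exists_dualInf.inter
        ((measurableSet_fringe_reachable 0 _ _).compl.inter
          (measurableSet_reachable measurableSet_primal_adj _ _)))))
  have hins : ∀ᵐ ω ∂μ, ∀ x y : ℤ, ¬ (PrimalInf 0 x ω ∧ PrimalInf 0 y ω ∧
      (∃ b, DualInf 0 b ω) ∧ ¬ (fringe (primal ω) 0).Reachable (x, 0) (y, 0)) := by
    refine ae_all_iff.2 fun x => ae_all_iff.2 fun y => ?_
    wlog hxy : x ≤ y generalizing x y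
    · filter_upwards [this y x (le_of_not_ge hxy)] with ω hω ⟨h1, h2, h3, h4⟩
      exact hω ⟨h2, h1, h3, fun h => h4 h.symm⟩
    -- The edges of the row `y = 0` are not edges of the fringed half-plane, and the dual edges that
    -- cross them leave the dual half-plane.
    set F : Finset Edge := (Finset.Ico x y).image fun z => ((z, 0), false) with hF
    filter_upwards [hμ.ae_openEdges F (hmeas x y) (hnull x y)] with ω hω ⟨hx, hy, hb, hne⟩
    have heq : ∀ e : Edge, e.1.2 ≠ 0 ∨ e.2 = true → ω e = openEdges F ω e := by
      intro e he
      rw [openEdges_of_notMem]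
      rintro heF
      obtain ⟨z, -, rfl⟩ := Finset.mem_image.1 heF
      simp at he
    have hfr : fringe (primal (openEdges F ω)) 0 = fringe (primal ω) 0 :=
      le_antisymm (fringe_le_of_eq fun e he => (heq e he).symm) (fringe_le_of_eq heq)
    have hdu : halfPlane (dual (openEdges F ω)) 0 = halfPlane (dual ω) 0 :=
      le_antisymm (halfPlane_dual_le_of_eq fun e he => (heq e he).symm)
        (halfPlane_dual_le_of_eq heq)
    refine hω ⟨by rwa [PrimalInf, hfr], by rwa [PrimalInf, hfr], by simpa only [DualInf, hdu],
      ?_, ?_⟩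
    · rwa [hfr]
    · have hreach : ∀ z, x ≤ z → z ≤ y → (primal (openEdges F ω)).Reachable (x, 0) (z, 0) := by
        intro z hxz
        induction z, hxz using Int.leInduction with
        | base => exact fun _ => .rfl
        | succ z hz ih =>
          intro hzy
          refine (ih (by omega)).trans (SimpleGraph.Adj.reachable (primal_adj.2 (Or.inl
            ⟨z, 0, openEdges_of_mem ?_ ω, Or.inl ⟨rfl, rfl⟩⟩)))
          exact Finset.mem_image_of_mem _ (Finset.mem_Ico.2 ⟨hz, by omega⟩)
      exact hreach y hxy le_rfl
  filter_upwards [hins, ae_boundaryCoexistence_sequence (μ := μ)] with ω hω hseq hW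
  obtain ⟨f, hf, hne⟩ := hseq hW
  exact hω (f 0) (f 1) ⟨hf 0, hf 1, hW.2,
    fun h => hne 0 1 one_pos (h.mono (fringe_le _ _))⟩

/-- Opening a vertical column of edges connects a given infinite cluster to the boundary. It destroys
only finitely many dual edges, so one of the infinitely many dual boundary vertices in infinite
clusters remains in an infinite cluster. -/
lemma ae_not_halfPlane_and_dualInf_of_insertionTolerant (hμ : InsertionTolerant μ) :
    ∀ᵐ ω ∂μ, ¬ ((∃ v, InInfiniteCluster (halfPlane (primal ω) 1) v) ∧ ∃ b, DualInf 0 b ω) := by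
  have hmeas : MeasurableSet {ω | ¬ BoundaryCoexistence 0 ω} :=
    (measurableSet_exists_primalInf.inter measurableSet_exists_dualInf).compl
  have hins : ∀ᵐ ω ∂μ, ∀ a i : ℤ, ¬ BoundaryCoexistence 0
      (openEdges ((Finset.Ico 0 i).image fun y => ((a, y), true)) ω) :=
    ae_all_iff.2 fun a => ae_all_iff.2 fun i => hμ.ae_openEdges _ hmeas
      (ae_not_boundaryCoexistence_of_insertionTolerant hμ)
  filter_upwards [hins, ae_dualInf_recurrent (μ := μ)] with ω hω hD
  rintro ⟨⟨⟨a, i⟩, hai⟩, ⟨b, hb⟩⟩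
  have hi : 1 ≤ i := le_of_inInfiniteCluster_halfPlane hai
  refine hω a i ?_
  set F : Finset Edge := (Finset.Ico 0 i).image fun y => ((a, y), true) with hF
  constructor
  · refine ⟨a, ?_⟩
    have hinf : InInfiniteCluster (fringe (primal (openEdges F ω)) 0) (a, i) := by
      refine hai.mono fun u v huv => ?_
      exact halfPlane_le_fringe _ 0 ⟨primal_le_openEdges F ω huv.1, huv.2⟩
    have hreach : ∀ y, 0 ≤ y → y ≤ i →
        (fringe (primal (openEdges F ω)) 0).Reachable (a, 0) (a, y) := by
      intro y hy
      induction y, hy using Int.leInduction with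
      | base => exact fun _ => .rfl
      | succ y hy ih =>
        intro hyi
        refine (ih (by omega)).trans (SimpleGraph.Adj.reachable ⟨primal_adj.2 (Or.inr
          ⟨a, y, openEdges_of_mem ?_ ω, Or.inl ⟨rfl, rfl⟩⟩), hy, by dsimp only; omega,
          Or.inr (by dsimp only; omega)⟩)
        exact Finset.mem_image_of_mem _ (Finset.mem_Ico.2 ⟨hy, by omega⟩)
    exact hinf.of_reachable (hreach i (by omega) le_rfl).symm
  · have hT : {t : ℤ × ℤ | t.2 = 0 ∧ DualInf 0 t.1 ω}.Infinite := by
      refine Set.Infinite.of_image Prod.fst (Set.infinite_of_not_bddAbove ?_)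
      rintro ⟨N, hN⟩
      obtain ⟨y, hyN, hy⟩ := (hD b hb N).1
      exact hyN.not_ge (hN ⟨(y, 0), ⟨rfl, hy⟩, rfl⟩)
    obtain ⟨⟨t, s⟩, ⟨hs, -⟩, ht⟩ := exists_inInfiniteCluster_of_finite_change
      (G := halfPlane (dual ω) 0) (H := halfPlane (dual (openEdges F ω)) 0)
      ((Set.finite_Icc (a - 1) a).prod (Set.finite_Ico 0 i)) hT
      (by rintro ⟨t, s⟩ ⟨hs, ht⟩; obtain rfl : s = 0 := hs; exact ht) (by
        rintro u v hu ⟨hadj, hu0, hv0⟩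
        refine ⟨dual_adj.2 ?_, hu0, hv0⟩
        rcases dual_adj.1 hadj with ⟨x, y, he, huv⟩ | ⟨x, y, he, huv⟩
        · refine Or.inl ⟨x, y, ?_, huv⟩
          rw [openEdges_of_notMem (by simp [hF]), he]
        · refine Or.inr ⟨x, y, ?_, huv⟩
          rw [openEdges_of_notMem, he]
          intro hmem
          simp only [hF, Finset.mem_image, Finset.mem_Ico, Prod.mk.injEq, and_true] at hmem
          obtain ⟨z, hz, rfl, rfl⟩ := hmem
          rw [Set.mem_prod, Set.mem_Icc, Set.mem_Ico] at hu
          rcases huv with ⟨rfl, rfl⟩ | ⟨rfl, rfl⟩ <;> dsimp only at hu <;> omega)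
    obtain rfl : s = 0 := hs
    exact ⟨t, ht⟩

end Insertion

end Z2

theorem theorem2 (μ : MeasureTheory.Measure Z2.Config) [MeasureTheory.IsProbabilityMeasure μ]
    [ErgodicVAdd (ℤ × ℤ) Z2.Config μ]
    (hAB : (∀ᵐ ω ∂μ, (Z2.infiniteClusters (Z2.primal ω)).Finite) ∨
      (Z2.InsertionTolerant μ ∧ Z2.DeletionTolerant μ)) :
    ∀ᵐ ω ∂μ, ¬ Z2.HalfPlaneCoexistence ω := by
  open Z2 in
  rcases hAB with hA | ⟨hB, -⟩
  · have hW : ∀ᵐ ω ∂μ, ¬ BoundaryCoexistence 0 ω := by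
      filter_upwards [hA, ae_boundaryCoexistence_sequence (μ := μ)] with ω hfin hseq hW
      obtain ⟨f, hf, hne⟩ := hseq hW
      exact infiniteClusters_infinite (fun n => (f n, (0 : ℤ)))
        (fun n => (hf n).mono (fringe_le _ _)) hne hfin
    filter_upwards [hA, ae_forall_not_boundaryCoexistence hW, ae_primal_halfPlane μ,
      ae_dual_halfPlane μ] with ω hfin hno hP hD ⟨h1, h2⟩
    exact infiniteClusters_primal_infinite (hP (exists_inInfiniteCluster_of_upper h1))
      (hD (exists_inInfiniteCluster_of_upper h2)) hno hfin
  · have hno : ∀ᵐ ω ∂μ, ∀ r : ℤ, ¬ ((∃ v, InInfiniteCluster (halfPlane (primal ω) (r + 1)) v) ∧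
        ∃ b, DualInf r b ω) := by
      refine MeasureTheory.ae_all_iff.2 fun r =>
        (ae_translate (ae_not_halfPlane_and_dualInf_of_insertionTolerant hB) (0, -r)).mono fun ω hω => ?_
      rw [exists_inInfiniteCluster_shift (halfPlane_primal_vadd_adj (0, -r) ω 1)] at hω
      simpa [dualInf_vadd, add_comm] using hω
    filter_upwards [hno, ae_primal_halfPlane μ] with ω hω hP ⟨h1, h2⟩
    obtain ⟨v, hv⟩ := exists_inInfiniteCluster_of_upper h2
    obtain ⟨⟨b, r⟩, hr, hb⟩ := exists_lowest hv
    have hr' : 0 ≤ r := hr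
    refine hω r ⟨?_, b, hb⟩
    have := hP (exists_inInfiniteCluster_of_upper h1) (r + 1).toNat
    rwa [Int.toNat_of_nonneg (by omega)] at this
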